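/- For $\Lambda=(\lambda_0,\dots,\lambda_n)\in\mathbb C^{n+1}$ let $E_\Lambda=\{f\in C^\infty(\mathbb R,\mathbb C): (\tfrac{d}{dx}-\lambda_0)\cdots(\tfrac{d}{dx}-\lambda_n)f=0\}$. For $a\ne b$, the Bernstein basis of $E_\Lambda$ with respect to $a,b$ is the system $p_{\Lambda,0},\dots,p_{\Lambda,n}\in E_\Lambda$ such that $p_{\Lambda,k}$ has a zero of order exactly $k$ at $a$ and a zero of order exactly $n-k$ at $b$, normalized by $p_{\Lambda,k}^{(k)}(a)=1$. Let $n\ge 1$ and let $\lambda_0,\dots,\lambda_n$ be complex numbers with $\lambda_0,\lambda_1$ real and $\lambda_0<\lambda_1$. Suppose that $E_{(\lambda_0,\dots,\lambda_n)}$ is closed under complex conjugation and that $0<b-a<\pi/M_n$, where $M_n=\max\{|\operatorname{Im}\lambda_j|: j=0,\dots,n\}$ (and $\pi/0:=\infty$). Then the Bernstein bases of $E_{(\lambda_0,\dots,\lambda_n)}$, $E_{(\lambda_1,\dots,\lambda_n)}$ and $E_{(\lambda_0,\lambda_2,\dots,\lambda_n)}$ with respect to $a,b$ exist and are unique, and the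 following hold. Real numbers $t_0,\dots,t_n$ are well defined inductively by $t_0=a$ and $$e^{(\lambda_0-\lambda_1)(t_k-t_{k-1})}=\lim_{x\to b}\frac{p_{(\lambda_0,\lambda_2,\dots,\lambda_n),k-1}(x)}{p_{(\lambda_1,\dots,\lambda_n),k-1}(x)},\qquad k=1,\dots,n,$$ and they satisfy $a=t_0<t_1<\dots<t_n=b$. Put $\alpha_0=1$ and $$\alpha_k=e^{-\lambda_0(t_k-a)}(-1)^k\prod_{l=0}^{k-1}\lim_{x\to b}\frac{\frac{d}{dx}p_{(\lambda_0,\dots,\lambda_n),l}(x)}{p_{(\lambda_1,\dots,\lambda_n),l}(x)},\qquad k=1,\dots,n,$$ where the limits exist and are real. Then $\alpha_0,\dots,\alpha_n>0$, and the operator $B$ on $C[a,b]$ defined by $$Bf=\sum_{k=0}^n\alpha_k f(t_k)\,p_{(\lambda_0,\dots,\lambda_n),k}$$ fixes the functions $e^{\lambda_0x}$ and $e^{\lambda_1x}$. Moreover, the $t_k$ and $\alpha_k$ are unique: if real numbers $t_0',\dots,t_n'$ and $\alpha_0',\dots,\alpha_n'$ satisfy $\sum_{k=0}^n\alpha_k'e^{\lambda_i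 t_k'}p_{(\lambda_0,\dots,\lambda_n),k}(x)=e^{\lambda_ix}$ for all $x\in[a,b]$ and $i=0,1$, then $t_k'=t_k$ and $\alpha_k'=\alpha_k$ for all $k$. -/

import Mathlib

/-- The differential operator `(d/dx - Λ 0) ⋯ (d/dx - Λ (N-1))` applied to `f : ℝ → ℂ`. -/
noncomputable def expDiffOp {N : ℕ} (Λ : Fin N → ℂ) (f : ℝ → ℂ) : ℝ → ℂ :=
  (List.ofFn Λ).foldr (fun μ g x => deriv g x - μ * g x) f

/-- The space `E_Λ` of exponential polynomials: smooth complex-valued functions on the real line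
annihilated by the differential operator with eigenvalues `Λ`. -/
def expPoly {N : ℕ} (Λ : Fin N → ℂ) : Set (ℝ → ℂ) :=
  {f | ContDiff ℝ ((⊤ : ℕ∞) : WithTop ℕ∞) f ∧ ∀ x, expDiffOp Λ f x = 0}

/-- A set of complex-valued functions is closed under complex conjugation. -/
def ClosedUnderConj (U : Set (ℝ → ℂ)) : Prop :=
  ∀ f ∈ U, (fun x => (starRingEnd ℂ) (f x)) ∈ U

/-- `f` has a zero of order (exactly) `k` at `c`. -/
def HasZeroOfOrder (f : ℝ → ℂ) (k : ℕ) (c : ℝ) : Prop :=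
  (∀ j < k, iteratedDeriv j f c = 0) ∧ iteratedDeriv k f c ≠ 0

/-- `p 0, …, p n` is a Bernstein basis of `E_(Λ 0, …, Λ n)` for the points `a, b`: `p k` lies in
the space, has a zero of order `k` at `a` and one of order `n - k` at `b`, and is normalized by
`(p k)^(k) (a) = 1`. -/
def IsBernsteinBasis {n : ℕ} (Λ : Fin (n + 1) → ℂ) (a b : ℝ) (p : Fin (n + 1) → ℝ → ℂ) : Prop :=
  ∀ k : Fin (n + 1), p k ∈ expPoly Λ ∧ HasZeroOfOrder (p k) k a ∧
    HasZeroOfOrder (p k) (n - k) b ∧ iteratedDeriv k (p k) a = 1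

/-- The Bernstein basis of `E_Λ` for `a, b` (an arbitrary family if there is none). -/
noncomputable def bernsteinBasis {n : ℕ} (Λ : Fin (n + 1) → ℂ) (a b : ℝ) :
    Fin (n + 1) → ℝ → ℂ :=
  Classical.epsilon (IsBernsteinBasis Λ a b)

/-- The largest modulus of the imaginary parts of the eigenvalues. -/
noncomputable def maxAbsIm {n : ℕ} (Λ : Fin (n + 1) → ℂ) : ℝ :=
  Finset.univ.sup' Finset.univ_nonempty (fun j => |(Λ j).im|)

/-- The operator `f ↦ ∑ k, α k * f (t k) * p_{Λ,k}`. It uses only the values of `f` at the nodes,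
hence acts on `C[a,b]` when the nodes lie in `[a,b]`. -/
noncomputable def bernsteinOp {n : ℕ} (Λ : Fin (n + 1) → ℂ) (a b : ℝ) (t α : Fin (n + 1) → ℝ)
    (f : ℝ → ℂ) : ℝ → ℂ :=
  fun x => ∑ k, (α k : ℂ) * f (t k) * bernsteinBasis Λ a b k x

/-- The function `x ↦ e^{c x}` on the real line. -/
noncomputable def expFun (c : ℝ) : ℝ → ℂ := fun x => (Real.exp (c * x) : ℂ)

/-!
A monic real operator `Q(d/dx)` whose characteristic roots satisfy `(b - a) |Im z| < π` factors on
`[a, b]` into operators that lose at most as many zeros as their order: `d/dx - r` by Rolle's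
theorem, and `d²/dx² - 2α d/dx + (α² + β²)` by Rolle's theorem applied twice, after division by its
solution `e^{α x} cos (β (x - (a + b) / 2))`, which has no zeros. Hence a nonzero function in `E_Λ`
has at most `n` zeros on `[a, b]`, which gives the Bernstein basis by Hermite interpolation and
determines the signs of the leading derivatives of its members at `b`.

If `e^{λᵢ x} = ∑ β_k p_k`, then `d/dx - λᵢ`, applied to the sum up to `k`, yields a multiple of the
`k`-th Bernstein function of the space without `λᵢ`. Comparing leading derivatives at `a` and `b`
expresses `β_{k+1} / β_k` as a positive ratio of leading derivatives at `b`. So all coefficients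
`x_k` of `e^{λ₀ x}` and `y_k` of `e^{λ₁ x}` are positive, and `α_k e^{λ₀ t_k} = x_k`,
`α_k e^{λ₁ t_k} = y_k` has exactly one solution. The nodes increase because the leading derivatives
at `b` of the Bernstein functions are larger in modulus for the space without `λ₀` than for the
space without `λ₁`.
-/

open Filter Finset Polynomial Set Topology
open scoped ContDiff ComplexConjugate

/-! ### Smooth functions and the order of their zeros -/

/-- The algebra of smooth functions `ℝ → 𝕜`, on which polynomials in `d/dx` act. -/
def smoothFun (𝕜 : Type*) [RCLike 𝕜] : Subalgebra 𝕜 (ℝ → 𝕜) where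
  carrier := {f | ContDiff ℝ ∞ f}
  mul_mem' (hf : ContDiff ℝ ∞ _) (hg : ContDiff ℝ ∞ _) := hf.mul hg
  add_mem' (hf : ContDiff ℝ ∞ _) (hg : ContDiff ℝ ∞ _) := hf.add hg
  algebraMap_mem' _ := (contDiff_const : ContDiff ℝ ∞ _)

namespace smoothFun

variable {𝕜 : Type*} [RCLike 𝕜]

instance : CoeFun (smoothFun 𝕜) fun _ ↦ ℝ → 𝕜 := ⟨Subtype.val⟩

@[ext]
theorem ext {f g : smoothFun 𝕜} (h : ∀ x, f x = g x) : f = g :=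
  Subtype.ext (funext h)

theorem mem_iff {f : ℝ → 𝕜} : f ∈ smoothFun 𝕜 ↔ ContDiff ℝ ∞ f := Iff.rfl

theorem contDiff (f : smoothFun 𝕜) : ContDiff ℝ ∞ f := f.2

theorem differentiable (f : smoothFun 𝕜) : Differentiable ℝ f :=
  (contDiff f).differentiable (by simp)

theorem continuous (f : smoothFun 𝕜) : Continuous f := (contDiff f).continuous

/-- Differentiation as an endomorphism of the space of smooth functions. -/
noncomputable def D : Module.End 𝕜 (smoothFun 𝕜) where
  toFun f := ⟨deriv f, (contDiff_infty_iff_deriv.1 (contDiff f)).2⟩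
  map_add' f g := ext fun x ↦ deriv_add (differentiable f x) (differentiable g x)
  map_smul' c f := ext fun x ↦ deriv_const_smul c (differentiable f x)

theorem hasDerivAt (f : smoothFun 𝕜) (x : ℝ) : HasDerivAt f (D f x) x :=
  (differentiable f x).hasDerivAt

theorem D_eq {f g : smoothFun 𝕜} (h : ∀ x, HasDerivAt f (g x) x) : D f = g :=
  ext fun x ↦ (h x).deriv

theorem D_mul (f g : smoothFun 𝕜) : D (f * g) = D f * g + f * D g :=
  ext fun x ↦ deriv_mul (differentiable f x) (differentiable g x)

theorem D_pow_succ_apply (j : ℕ) (f : smoothFun 𝕜) : (D ^ (j + 1)) f = (D ^ j) (D f) := by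
  rw [pow_succ, Module.End.mul_apply]

theorem D_pow_sub_apply (j : ℕ) (f g : smoothFun 𝕜) (x : ℝ) :
    (D ^ j) (f - g) x = (D ^ j) f x - (D ^ j) g x := by
  rw [map_sub]
  rfl

theorem D_pow_smul_apply (j : ℕ) (c : 𝕜) (f : smoothFun 𝕜) (x : ℝ) :
    (D ^ j) (c • f) x = c * (D ^ j) f x := by
  rw [map_smul]
  rfl

theorem coe_D_pow (j : ℕ) (f : smoothFun 𝕜) : ⇑((D ^ j) f) = iteratedDeriv j f := by
  induction j generalizing f with
  | zero => rw [pow_zero, Module.End.one_apply, iteratedDeriv_zero]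
  | succ j ih => rw [D_pow_succ_apply, ih, iteratedDeriv_succ']; rfl

/-- The ideal of the smooth functions with a zero of order at least `i` at `c`. -/
noncomputable def vanishingIdeal (c : ℝ) (i : ℕ) : Ideal (smoothFun 𝕜) where
  carrier := {f | ∀ j < i, (D ^ j) f c = 0}
  zero_mem' j _ := by rw [map_zero]; rfl
  add_mem' {f g} hf hg j hj := by
    simp only [map_add, AddMemClass.coe_add, Pi.add_apply, hf j hj, hg j hj, add_zero]
  smul_mem' w f hf j hj := by
    rw [coe_D_pow, smul_eq_mul, MulMemClass.coe_mul,
      iteratedDeriv_mul ((contDiff w).of_le (by exact_mod_cast le_top)).contDiffAt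
        ((contDiff f).of_le (by exact_mod_cast le_top)).contDiffAt]
    refine Finset.sum_eq_zero fun l _ ↦ ?_
    rw [← coe_D_pow (j - l), hf _ (by lia), mul_zero]

section vanishingIdeal

variable {f g w : smoothFun 𝕜} {c : ℝ} {i j : ℕ}

theorem mem_vanishingIdeal : f ∈ vanishingIdeal c i ↔ ∀ j < i, (D ^ j) f c = 0 := Iff.rfl

theorem mem_vanishingIdeal_zero : f ∈ vanishingIdeal c 0 :=
  fun _ h ↦ absurd h (Nat.not_lt_zero _)

theorem vanishingIdeal_mono (hij : i ≤ j) (hf : f ∈ vanishingIdeal c j) : f ∈ vanishingIdeal c i :=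
  fun l hl ↦ hf l (hl.trans_le hij)

theorem mem_vanishingIdeal_succ :
    f ∈ vanishingIdeal c (i + 1) ↔ f ∈ vanishingIdeal c i ∧ (D ^ i) f c = 0 := by
  simp only [mem_vanishingIdeal, Nat.forall_lt_succ_right]

theorem mem_vanishingIdeal_succ' :
    f ∈ vanishingIdeal c (i + 1) ↔ f c = 0 ∧ D f ∈ vanishingIdeal c i := by
  simp only [mem_vanishingIdeal, Nat.forall_lt_succ_left, D_pow_succ_apply, pow_zero,
    Module.End.one_apply]

theorem D_mem_vanishingIdeal (hf : f ∈ vanishingIdeal c i) : D f ∈ vanishingIdeal c (i - 1) := by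
  rcases i with _ | i
  exacts [mem_vanishingIdeal_zero, (mem_vanishingIdeal_succ'.1 hf).2]

theorem D_sub_smul_mem_vanishingIdeal (μ : 𝕜) (hf : f ∈ vanishingIdeal c i) :
    D f - μ • f ∈ vanishingIdeal c (i - 1) :=
  sub_mem (D_mem_vanishingIdeal hf)
    (Submodule.smul_of_tower_mem _ _ (vanishingIdeal_mono (Nat.sub_le i 1) hf))

theorem D_pow_D_sub_smul (μ : 𝕜) (hf : f ∈ vanishingIdeal c (i + 1)) :
    (D ^ i) (D f - μ • f) c = (D ^ (i + 1)) f c := by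
  rw [D_pow_sub_apply, D_pow_smul_apply, ← D_pow_succ_apply, hf i i.lt_succ_self, mul_zero,
    sub_zero]

theorem mem_vanishingIdeal_of_mul_mem (hw : w c ≠ 0) (h : w * f ∈ vanishingIdeal c i) :
    f ∈ vanishingIdeal c i := by
  induction i generalizing f with
  | zero => exact mem_vanishingIdeal_zero
  | succ i ih =>
    obtain ⟨hwf, hD⟩ := mem_vanishingIdeal_succ'.1 h
    have hf : f ∈ vanishingIdeal c i := ih (vanishingIdeal_mono i.le_succ h)
    rw [D_mul] at hD
    exact mem_vanishingIdeal_succ'.2 ⟨(mul_eq_zero.1 hwf).resolve_left hw,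
      ih ((Ideal.add_mem_iff_right _ (Ideal.mul_mem_left _ _ hf)).1 hD)⟩

theorem mem_vanishingIdeal_of_eqOn_Icc {a b : ℝ} (hab : a < b) (hf : ∀ x ∈ Icc a b, f x = 0)
    (hc : c ∈ Icc a b) (i : ℕ) : f ∈ vanishingIdeal c i := by
  intro j _
  have hIoo : ∀ x ∈ Ioo a b, (D ^ j) f x = 0 := by
    intro x hx
    have hloc : (f : ℝ → 𝕜) =ᶠ[𝓝 x] fun _ ↦ 0 :=
      mem_of_superset (Icc_mem_nhds hx.1 hx.2) hf
    rw [coe_D_pow, hloc.iteratedDeriv_eq, iteratedDeriv_const]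
    simp
  have hclosed : IsClosed {x | (D ^ j) f x = 0} := isClosed_eq (continuous _) continuous_const
  exact closure_minimal hIoo hclosed (by rwa [closure_Ioo hab.ne])

/-- Taylor's formula: the leading monomial of `f` at a zero of order at least `j`. -/
theorem tendsto_inv_pow_smul (hf : f ∈ vanishingIdeal c j) :
    Tendsto (fun x ↦ ((x - c) ^ j)⁻¹ • f x) (𝓝[≠] c) (𝓝 ((j.factorial : ℝ)⁻¹ • (D ^ j) f c)) := by
  have htaylor : ∀ x, taylorWithinEval f j univ c x
      = ((j.factorial : ℝ)⁻¹ * (x - c) ^ j) • (D ^ j) f c := by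
    intro x
    rw [taylor_within_apply, Finset.sum_range_succ, Finset.sum_eq_zero, zero_add,
      iteratedDerivWithin_univ, coe_D_pow]
    intro l hl
    rw [iteratedDerivWithin_univ, ← coe_D_pow, hf l (Finset.mem_range.1 hl), smul_zero]
  have hrem := taylor_tendsto (n := j) convex_univ (mem_univ c)
    ((contDiff f).of_le (by exact_mod_cast le_top)).contDiffOn
  rw [nhdsWithin_univ] at hrem
  have hlim := (hrem.mono_left (nhdsWithin_le_nhds (s := {c}ᶜ))).add_const
    ((j.factorial : ℝ)⁻¹ • (D ^ j) f c)
  rw [zero_add] at hlim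
  refine hlim.congr' ?_
  filter_upwards [self_mem_nhdsWithin] with x hx
  have hx' : (x - c) ^ j ≠ 0 := pow_ne_zero _ (sub_ne_zero.2 hx)
  rw [htaylor, smul_sub, smul_smul, mul_left_comm, inv_mul_cancel₀ hx', mul_one, sub_add_cancel]

theorem tendsto_div (hf : f ∈ vanishingIdeal c j) (hg : g ∈ vanishingIdeal c j)
    (hgj : (D ^ j) g c ≠ 0) :
    Tendsto (fun x ↦ f x / g x) (𝓝[≠] c) (𝓝 ((D ^ j) f c / (D ^ j) g c)) := by
  have smul_div_smul {r : ℝ} (hr : r ≠ 0) (u v : 𝕜) : (r • u) / (r • v) = u / v := by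
    rw [RCLike.real_smul_eq_coe_mul, RCLike.real_smul_eq_coe_mul,
      mul_div_mul_left _ _ (by exact_mod_cast hr)]
  have hj : (j.factorial : ℝ)⁻¹ ≠ 0 := inv_ne_zero (by exact_mod_cast j.factorial_ne_zero)
  have h := (tendsto_inv_pow_smul hf).div (tendsto_inv_pow_smul hg) (smul_ne_zero hj hgj)
  rw [smul_div_smul hj] at h
  refine h.congr' ?_
  filter_upwards [self_mem_nhdsWithin] with x hx
  exact smul_div_smul (inv_ne_zero (pow_ne_zero _ (sub_ne_zero.2 hx))) _ _

end vanishingIdeal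

end smoothFun

/-! ### Rolle's theorem for products of operators -/

namespace smoothFun

section exp

variable {𝕜 : Type*} [RCLike 𝕜]

/-- The function `x ↦ e^{μ x}`, the eigenfunction of `d/dx` for the eigenvalue `μ`. -/
noncomputable def exp (μ : 𝕜) : smoothFun 𝕜 :=
  ⟨fun x ↦ NormedSpace.exp (x • μ),
    mem_iff.2 <| contDiff_iff_contDiffAt.2 fun _ ↦
      (NormedSpace.exp_analytic (𝕂 := ℝ) _).contDiffAt.comp _ (by fun_prop)⟩

theorem exp_apply (μ : 𝕜) (x : ℝ) : exp μ x = NormedSpace.exp (x • μ) := rfl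

theorem D_exp (μ : 𝕜) : D (exp μ) = μ • exp μ :=
  D_eq fun x ↦ (hasDerivAt_exp_smul_const μ x).congr_deriv (mul_comm _ _)

theorem exp_ne_zero (μ : 𝕜) (x : ℝ) : exp μ x ≠ 0 :=
  (NormedSpace.isUnit_exp _).ne_zero

end exp

/-- The Wronskian of two smooth functions. -/
noncomputable def wronskian (w f : smoothFun ℝ) : smoothFun ℝ := w * D f - D w * f

theorem wronskian_apply (w f : smoothFun ℝ) (x : ℝ) :
    wronskian w f x = w x * D f x - D w x * f x := rfl

theorem hasDerivAt_div (w f : smoothFun ℝ) {x : ℝ} (hx : w x ≠ 0) :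
    HasDerivAt (fun y ↦ f y / w y) (wronskian w f x / w x ^ 2) x := by
  refine ((hasDerivAt f x).div (hasDerivAt w x) hx).congr_deriv ?_
  rw [wronskian_apply]
  ring

theorem wronskian_mem_vanishingIdeal {f : smoothFun ℝ} {c : ℝ} {i : ℕ} (w : smoothFun ℝ)
    (hf : f ∈ vanishingIdeal c i) : wronskian w f ∈ vanishingIdeal c (i - 1) :=
  Ideal.sub_mem _ (Ideal.mul_mem_left _ _ (D_mem_vanishingIdeal hf))
    (vanishingIdeal_mono (i.sub_le 1) (Ideal.mul_mem_left _ _ hf))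

section Rolle

variable {a b : ℝ} {f w : smoothFun ℝ} {c d e : ℕ}

/-- `f` has at least `c` zeros in `[a, b]`, where only the endpoints are counted with
multiplicity. -/
def HasZeros (a b : ℝ) (f : smoothFun ℝ) (c : ℕ) : Prop :=
  ∃ (i j : ℕ) (s : Finset ℝ), c ≤ i + j + #s ∧ f ∈ vanishingIdeal a i ∧ f ∈ vanishingIdeal b j ∧
    ∀ x ∈ s, x ∈ Ioo a b ∧ f x = 0

theorem HasZeros.mono (hf : HasZeros a b f c) (hd : d ≤ c) : HasZeros a b f d := by
  obtain ⟨i, j, s, hc, hzeros⟩ := hf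
  exact ⟨i, j, s, hd.trans hc, hzeros⟩

theorem HasZeros.of_mul (hab : a < b) (hw : ∀ x ∈ Icc a b, w x ≠ 0)
    (h : HasZeros a b (w * f) c) : HasZeros a b f c := by
  obtain ⟨i, j, s, hc, hi, hj, hs⟩ := h
  refine ⟨i, j, s, hc, mem_vanishingIdeal_of_mul_mem (hw a (left_mem_Icc.2 hab.le)) hi,
    mem_vanishingIdeal_of_mul_mem (hw b (right_mem_Icc.2 hab.le)) hj, fun x hx ↦ ⟨(hs x hx).1, ?_⟩⟩
  exact (mul_eq_zero.1 (hs x hx).2).resolve_left (hw x (Ioo_subset_Icc_self (hs x hx).1))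

theorem HasZeros.exists_eq_zero (hab : a < b) (h : HasZeros a b f (c + 1)) :
    ∃ x ∈ Icc a b, f x = 0 := by
  obtain ⟨_ | i, _ | j, s, hc, hi, hj, hs⟩ := h
  · obtain ⟨x, hx⟩ := Finset.card_pos.1 (show 0 < #s by lia)
    exact ⟨x, Ioo_subset_Icc_self (hs x hx).1, (hs x hx).2⟩
  · exact ⟨b, right_mem_Icc.2 hab.le, (mem_vanishingIdeal_succ'.1 hj).1⟩
  all_goals exact ⟨a, left_mem_Icc.2 hab.le, (mem_vanishingIdeal_succ'.1 hi).1⟩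

theorem exists_wronskian_eq_zero {x y : ℝ} (hxy : x < y) (hw : ∀ z ∈ Icc x y, w z ≠ 0)
    (hx : f x = 0) (hy : f y = 0) : ∃ z ∈ Ioo x y, wronskian w f z = 0 := by
  have hderiv : ∀ z ∈ Icc x y, HasDerivAt (fun t ↦ f t / w t) (wronskian w f z / w z ^ 2) z :=
    fun z hz ↦ hasDerivAt_div w f (hw z hz)
  obtain ⟨z, hz, h⟩ := exists_hasDerivAt_eq_zero hxy (HasDerivAt.continuousOn hderiv)
    (by rw [hx, hy, zero_div, zero_div]) fun z hz ↦ hderiv z (Ioo_subset_Icc_self hz)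
  exact ⟨z, hz, (div_eq_zero_iff.1 h).resolve_right
    (pow_ne_zero _ (hw z (Ioo_subset_Icc_self hz)))⟩

theorem exists_finset_wronskian_eq_zero (hw : ∀ x ∈ Icc a b, w x ≠ 0) {s : Finset ℝ}
    (hs : ∀ x ∈ s, x ∈ Icc a b) (hf : ∀ x ∈ s, f x = 0) :
    ∃ t : Finset ℝ, #s ≤ #t + 1 ∧ ∀ z ∈ t, z ∈ Ioo a b ∧ wronskian w f z = 0 := by
  have hrolle : ∀ p ∈ (s ×ˢ s).filter fun p ↦ p.1 < p.2,
      ∃ z ∈ Ioo p.1 p.2, wronskian w f z = 0 := by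
    intro p hp
    obtain ⟨⟨h₁, h₂⟩, hlt⟩ := by simpa only [Finset.mem_filter, Finset.mem_product] using hp
    exact exists_wronskian_eq_zero hlt
      (fun z hz ↦ hw z (Icc_subset_Icc (hs _ h₁).1 (hs _ h₂).2 hz)) (hf _ h₁) (hf _ h₂)
  choose! ζ hζ hζ₀ using hrolle
  refine ⟨((s ×ˢ s).filter fun p ↦ p.1 < p.2).image ζ, ?_, ?_⟩
  · refine Finset.card_le_of_interleaved fun x hx y hy hxy _ ↦ ?_
    have hp : (x, y) ∈ (s ×ˢ s).filter fun p ↦ p.1 < p.2 := by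
      simpa only [Finset.mem_filter, Finset.mem_product] using ⟨⟨hx, hy⟩, hxy⟩
    exact ⟨ζ (x, y), Finset.mem_image_of_mem ζ hp, hζ _ hp⟩
  · simp only [Finset.forall_mem_image]
    intro p hp
    have hmem := (Finset.mem_product.1 (Finset.mem_filter.1 hp).1)
    exact ⟨Ioo_subset_Ioo (hs _ hmem.1).1 (hs _ hmem.2).2 (hζ p hp), hζ₀ p hp⟩

theorem exists_finset_zeros_insert {x : ℝ} {i : ℕ} {s : Finset ℝ} (hx : x ∉ s)
    (hfx : f ∈ vanishingIdeal x i) (hs : ∀ y ∈ s, f y = 0) :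
    ∃ t ⊆ insert x s, (∀ y ∈ t, f y = 0) ∧ i + #s = i - 1 + #t := by
  rcases i with _ | i
  · exact ⟨s, Finset.subset_insert x s, hs, rfl⟩
  · refine ⟨insert x s, subset_rfl, ?_, ?_⟩
    · exact (Finset.forall_mem_insert _ _ _).2 ⟨(mem_vanishingIdeal_succ'.1 hfx).1, hs⟩
    · rw [Finset.card_insert_of_notMem hx]
      lia

theorem HasZeros.wronskian (hab : a < b) (hw : ∀ x ∈ Icc a b, w x ≠ 0)
    (hf : HasZeros a b f (c + 1)) : HasZeros a b (wronskian w f) c := by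
  obtain ⟨i, j, s, hc, hi, hj, hs⟩ := hf
  obtain ⟨t, hts, ht, htcard⟩ := exists_finset_zeros_insert (fun ha ↦ (hs a ha).1.1.false) hi
    fun x hx ↦ (hs x hx).2
  have htb : b ∉ t := fun hb ↦ by
    rcases Finset.mem_insert.1 (hts hb) with h | h
    exacts [hab.ne' h, (hs b h).1.2.false]
  obtain ⟨u, hut, hu, hucard⟩ := exists_finset_zeros_insert htb hj ht
  have huIcc : ∀ x ∈ u, x ∈ Icc a b := fun x hx ↦ by
    rcases Finset.mem_insert.1 (hut hx) with rfl | hx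
    · exact right_mem_Icc.2 hab.le
    rcases Finset.mem_insert.1 (hts hx) with rfl | hx
    exacts [left_mem_Icc.2 hab.le, Ioo_subset_Icc_self (hs x hx).1]
  obtain ⟨v, hv, hv₀⟩ := exists_finset_wronskian_eq_zero hw huIcc hu
  exact ⟨i - 1, j - 1, v, by lia, wronskian_mem_vanishingIdeal w hi,
    wronskian_mem_vanishingIdeal w hj, hv₀⟩

theorem eq_zero_of_wronskian_eq_zero (hw : ∀ x ∈ Icc a b, w x ≠ 0)
    (h : ∀ x ∈ Icc a b, wronskian w f x = 0) {z : ℝ} (hz : z ∈ Icc a b) (hfz : f z = 0) :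
    ∀ x ∈ Icc a b, f x = 0 := by
  have hderiv : ∀ x ∈ Icc a b, HasDerivAt (fun y ↦ f y / w y) 0 x := fun x hx ↦
    (hasDerivAt_div w f (hw x hx)).congr_deriv (by rw [h x hx, zero_div])
  have hconst := constant_of_has_deriv_right_zero (HasDerivAt.continuousOn hderiv)
    fun x hx ↦ (hderiv x (Ico_subset_Icc_self hx)).hasDerivWithinAt
  intro x hx
  have hquot : f x / w x = 0 := by rw [hconst x hx, ← hconst z hz, hfz, zero_div]
  exact (div_eq_zero_iff.1 hquot).resolve_right (hw x hx)

/-- `L` behaves like a differential operator of order `d` that satisfies Rolle's theorem on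
`[a, b]`: it loses at most `d` zeros, and a function in its kernel with `d` zeros vanishes. -/
structure IsRolleOperator (a b : ℝ) (L : smoothFun ℝ → smoothFun ℝ) (d : ℕ) : Prop where
  hasZeros {f : smoothFun ℝ} {c : ℕ} : HasZeros a b f (c + d) → HasZeros a b (L f) c
  eq_zero {f : smoothFun ℝ} : HasZeros a b f d → (∀ x ∈ Icc a b, L f x = 0) →
    ∀ x ∈ Icc a b, f x = 0

namespace IsRolleOperator

variable {K L : smoothFun ℝ → smoothFun ℝ}

protected theorem id : IsRolleOperator a b id 0 where
  hasZeros h := h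
  eq_zero _ h := h

theorem comp (hL : IsRolleOperator a b L d) (hK : IsRolleOperator a b K e) :
    IsRolleOperator a b (L ∘ K) (d + e) where
  hasZeros h := hL.hasZeros (hK.hasZeros (by rwa [add_assoc]))
  eq_zero hf h := hK.eq_zero (hf.mono (Nat.le_add_left e d)) (hL.eq_zero (hK.hasZeros hf) h)

protected theorem wronskian (hab : a < b) (hw : ∀ x ∈ Icc a b, w x ≠ 0) :
    IsRolleOperator a b (wronskian w) 1 where
  hasZeros h := h.wronskian hab hw
  eq_zero hf h := by
    obtain ⟨z, hz, hfz⟩ := HasZeros.exists_eq_zero hab hf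
    exact eq_zero_of_wronskian_eq_zero hw h hz hfz

theorem of_mul (hab : a < b) (hw : ∀ x ∈ Icc a b, w x ≠ 0)
    (h : IsRolleOperator a b (fun f ↦ w * L f) d) : IsRolleOperator a b L d where
  hasZeros hf := (h.hasZeros hf).of_mul hab hw
  eq_zero hf hL := h.eq_zero hf fun x hx ↦ mul_eq_zero_of_right _ (hL x hx)

theorem aeval_X_sub_C (hab : a < b) (r : ℝ) :
    IsRolleOperator a b (aeval D (X - C r : ℝ[X])) 1 := by
  have hexp : ∀ x ∈ Icc a b, exp r x ≠ 0 := fun x _ ↦ exp_ne_zero r x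
  refine of_mul hab hexp ?_
  have hfactor : wronskian (exp r) = fun f ↦ exp r * aeval D (X - C r : ℝ[X]) f := by
    funext f
    simp only [wronskian, D_exp, map_sub, aeval_X, aeval_C, LinearMap.sub_apply,
      Module.algebraMap_end_apply]
    algebra
  exact hfactor ▸ IsRolleOperator.wronskian hab hexp

end IsRolleOperator

/-- The function `x ↦ cos (β (x - c))`. -/
noncomputable def cos (β c : ℝ) : smoothFun ℝ :=
  ⟨fun x ↦ Real.cos (β * (x - c)), mem_iff.2 (by fun_prop)⟩

theorem D_D_cos (β c : ℝ) : D (D (cos β c)) = -β ^ 2 • cos β c := by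
  have haffine (x : ℝ) : HasDerivAt (fun x ↦ β * (x - c)) β x :=
    (((hasDerivAt_id x).sub_const c).const_mul β).congr_deriv (mul_one β)
  let sin : smoothFun ℝ := ⟨fun x ↦ Real.sin (β * (x - c)), mem_iff.2 (by fun_prop)⟩
  have hcos : D (cos β c) = -β • sin :=
    D_eq fun x ↦ (haffine x).cos.congr_deriv (by change _ = -β * _; ring)
  have hsin : D sin = β • cos β c := D_eq fun x ↦ (haffine x).sin.congr_deriv (mul_comm _ _)
  rw [hcos, map_smul, hsin, smul_smul, neg_mul, pow_two]

theorem cos_ne_zero {β : ℝ} (h : (b - a) * |β| < Real.pi) {x : ℝ} (hx : x ∈ Icc a b) :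
    cos β ((a + b) / 2) x ≠ 0 := by
  have hdist : |x - (a + b) / 2| ≤ (b - a) / 2 := by
    rw [abs_le]
    constructor <;> linarith [hx.1, hx.2]
  have hlt : |β * (x - (a + b) / 2)| < Real.pi / 2 := by
    rw [abs_mul]
    nlinarith [abs_nonneg β]
  exact (Real.cos_pos_of_mem_Ioo (abs_lt.1 hlt)).ne'

/-- Pólya's factorization of a quadratic operator through a solution without zeros. -/
theorem wronskian_wronskian_cos (α β c : ℝ) (f : smoothFun ℝ) :
    wronskian (exp (2 * α)) (wronskian (exp α * cos β c) f) =
      exp (2 * α) * (exp α * cos β c *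
        aeval D (X ^ 2 - C (2 * α) * X + C (α ^ 2 + β ^ 2) : ℝ[X]) f) := by
  simp only [wronskian, D_mul, map_sub, map_add, map_smul, map_mul, aeval_X, aeval_C, D_exp,
    D_D_cos, LinearMap.sub_apply, LinearMap.add_apply, Module.End.mul_apply,
    Module.algebraMap_end_apply, pow_two]
  algebra

namespace IsRolleOperator

theorem aeval_quadratic (hab : a < b) {z : ℂ} (hz : (b - a) * |z.im| < Real.pi) :
    IsRolleOperator a b (aeval D (X ^ 2 - C (2 * z.re) * X + C (‖z‖ ^ 2) : ℝ[X])) 2 := by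
  have hsol : ∀ x ∈ Icc a b, (exp z.re * cos z.im ((a + b) / 2)) x ≠ 0 :=
    fun x hx ↦ mul_ne_zero (exp_ne_zero _ x) (cos_ne_zero hz hx)
  have hexp : ∀ x ∈ Icc a b, exp (2 * z.re) x ≠ 0 := fun x _ ↦ exp_ne_zero _ x
  rw [Complex.sq_norm, Complex.normSq_apply, ← pow_two, ← pow_two]
  refine of_mul hab hsol (of_mul hab hexp ?_)
  simp only [← wronskian_wronskian_cos]
  exact (IsRolleOperator.wronskian hab hexp).comp (IsRolleOperator.wronskian hab hsol)

theorem exists_dvd (hab : a < b) {Q : ℝ[X]} (hQ : Q.degree ≠ 0)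
    (hroots : ∀ z : ℂ, aeval z Q = 0 → (b - a) * |z.im| < Real.pi) :
    ∃ P : ℝ[X], P.Monic ∧ 0 < P.natDegree ∧ P ∣ Q ∧
      IsRolleOperator a b (aeval D P) P.natDegree := by
  obtain ⟨z, hz⟩ : ∃ z : ℂ, aeval z Q = 0 := IsAlgClosed.exists_aeval_eq_zero _ Q hQ
  by_cases hzim : z.im = 0
  · refine ⟨X - C z.re, monic_X_sub_C _, by simp, dvd_iff_isRoot.2 ?_, ?_⟩
    · rw [show z = algebraMap ℝ ℂ z.re from Complex.ext rfl hzim, aeval_algebraMap_apply] at hz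
      exact Complex.ofReal_eq_zero.1 hz
    · rw [natDegree_X_sub_C]
      exact aeval_X_sub_C hab z.re
  · have hdeg : (X ^ 2 - C (2 * z.re) * X + C (‖z‖ ^ 2)).natDegree = 2 := by compute_degree!
    refine ⟨_, by monicity!, by lia, Q.quadratic_dvd_of_aeval_eq_zero_im_ne_zero hz hzim, ?_⟩
    rw [hdeg]
    exact aeval_quadratic hab (hroots z hz)

protected theorem aeval (hab : a < b) {Q : ℝ[X]} (hQ : Q.Monic)
    (hroots : ∀ z : ℂ, aeval z Q = 0 → (b - a) * |z.im| < Real.pi) :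
    IsRolleOperator a b (aeval D Q) Q.natDegree := by
  induction hd : Q.natDegree using Nat.strong_induction_on generalizing Q with
  | _ d ih =>
  by_cases hdeg : Q.natDegree = 0
  · rw [hQ.natDegree_eq_zero.1 hdeg, map_one, ← hd, hdeg]
    exact IsRolleOperator.id
  obtain ⟨P, hP, hPdeg, ⟨R, rfl⟩, hrolle⟩ :=
    exists_dvd hab (fun h ↦ hdeg (natDegree_eq_of_degree_eq_some h)) hroots
  have hR : R.Monic := hP.of_mul_monic_left hQ
  rw [hP.natDegree_mul hR] at hd
  have hRrolle := ih R.natDegree (by lia) hR (fun z hz ↦ hroots z (by rw [map_mul, hz, mul_zero]))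
    rfl
  rw [← hd, map_mul]
  exact hrolle.comp hRrolle

end IsRolleOperator

end Rolle

end smoothFun

/-! ### Exponential polynomials -/

namespace smoothFun

variable {𝕜 : Type*} [RCLike 𝕜]

theorem exp_mul_exp_neg (μ : 𝕜) : exp μ * exp (-μ) = 1 := by
  ext x
  change NormedSpace.exp (x • μ) * NormedSpace.exp (x • -μ) = 1
  rw [← NormedSpace.exp_add, smul_neg, add_neg_cancel, NormedSpace.exp_zero]

theorem exists_D_eq (g : smoothFun 𝕜) (c : ℝ) (v : 𝕜) : ∃ f : smoothFun 𝕜, D f = g ∧ f c = v := by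
  have hderiv (x : ℝ) : HasDerivAt (fun x ↦ v + ∫ t in c..x, g t) (g x) x :=
    ((continuous g).integral_hasStrictDerivAt c x).hasDerivAt.const_add v
  have hsmooth : ContDiff ℝ ∞ fun x ↦ v + ∫ t in c..x, g t :=
    contDiff_infty_iff_deriv.2 ⟨fun x ↦ (hderiv x).differentiableAt, by
      rw [show deriv _ = g from funext fun x ↦ (hderiv x).deriv]
      exact contDiff g⟩
  exact ⟨⟨_, hsmooth⟩, D_eq hderiv, by simp⟩

theorem exists_D_sub_smul_eq (μ : 𝕜) (g : smoothFun 𝕜) (c : ℝ) (v : 𝕜) :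
    ∃ f : smoothFun 𝕜, D f - μ • f = g ∧ f c = v := by
  obtain ⟨h, hD, hc⟩ := exists_D_eq (exp (-μ) * g) c (exp (-μ) c * v)
  refine ⟨exp μ * h, ?_, ?_⟩
  · rw [D_mul, D_exp, hD, smul_mul_assoc, add_sub_cancel_left, ← mul_assoc, exp_mul_exp_neg,
      one_mul]
  · change exp μ c * h c = v
    rw [hc, ← mul_assoc]
    exact (congrArg (fun f : smoothFun 𝕜 ↦ f c * v) (exp_mul_exp_neg μ)).trans (one_mul v)

theorem eq_zero_of_D_eq_smul {μ : 𝕜} {f : smoothFun 𝕜} (h : D f = μ • f) {c : ℝ} (hc : f c = 0) :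
    f = 0 := by
  have hD : D (exp (-μ) * f) = 0 := by
    rw [D_mul, D_exp, h]
    algebra
  ext x
  have hconst : exp (-μ) x * f x = exp (-μ) c * f c :=
    is_const_of_deriv_eq_zero (differentiable (exp (-μ) * f))
      (fun y ↦ congrArg (fun g : smoothFun 𝕜 ↦ g y) hD) x c
  rw [hc, mul_zero] at hconst
  exact (mul_eq_zero.1 hconst).resolve_left (exp_ne_zero _ _)

/-- The `k`-jet `(f(c), f'(c), …, f⁽ᵏ⁻¹⁾(c))` of `f` at `c`. -/
noncomputable def jet (k : ℕ) (c : ℝ) : smoothFun 𝕜 →ₗ[𝕜] (Fin k → 𝕜) where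
  toFun f i := (D ^ (i : ℕ)) f c
  map_add' f g := by ext i; rw [map_add]; rfl
  map_smul' r f := by ext i; rw [map_smul]; rfl

theorem jet_eq_zero_iff {k : ℕ} {c : ℝ} {f : smoothFun 𝕜} :
    jet k c f = 0 ↔ f ∈ vanishingIdeal c k :=
  ⟨fun h j hj ↦ congrFun h ⟨j, hj⟩, fun h ↦ funext fun i ↦ h i i.2⟩

end smoothFun

open smoothFun

section expSpace

variable {𝕜 : Type*} [RCLike 𝕜] {N : ℕ} {f : smoothFun 𝕜}

/-- The characteristic polynomial of the differential operator with eigenvalues `Λ`. -/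
noncomputable def charPoly (Λ : Fin N → 𝕜) : 𝕜[X] := ∏ i, (X - C (Λ i))

theorem charPoly_monic (Λ : Fin N → 𝕜) : (charPoly Λ).Monic :=
  monic_prod_of_monic _ _ fun i _ ↦ monic_X_sub_C (Λ i)

theorem natDegree_charPoly (Λ : Fin N → 𝕜) : (charPoly Λ).natDegree = N := by
  rw [charPoly, natDegree_finsetProd_X_sub_C_eq_card, Finset.card_fin]

theorem charPoly_eq_mul_removeNth (Λ : Fin (N + 1) → 𝕜) (i : Fin (N + 1)) :
    charPoly Λ = (X - C (Λ i)) * charPoly (i.removeNth Λ) :=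
  Fin.prod_univ_succAbove _ i

/-- The space `E_Λ` as a space of smooth functions: the kernel of the polynomial `charPoly Λ` in
`d/dx`. -/
noncomputable def expSpace (Λ : Fin N → 𝕜) : Submodule 𝕜 (smoothFun 𝕜) :=
  LinearMap.ker (aeval D (charPoly Λ))

theorem mem_expSpace {Λ : Fin N → 𝕜} : f ∈ expSpace Λ ↔ aeval D (charPoly Λ) f = 0 :=
  LinearMap.mem_ker

theorem aeval_D_X_sub_C (μ : 𝕜) (f : smoothFun 𝕜) : aeval D (X - C μ) f = D f - μ • f := by
  rw [map_sub, aeval_X, aeval_C, LinearMap.sub_apply, Module.algebraMap_end_apply]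

variable {Λ : Fin (N + 1) → 𝕜} (i : Fin (N + 1))

theorem removeNth_mem_expSpace (hf : f ∈ expSpace (i.removeNth Λ)) : f ∈ expSpace Λ := by
  rw [mem_expSpace] at hf ⊢
  rw [charPoly_eq_mul_removeNth Λ i, map_mul, Module.End.mul_apply, hf, map_zero]

theorem D_sub_smul_mem_expSpace_iff :
    D f - Λ i • f ∈ expSpace (i.removeNth Λ) ↔ f ∈ expSpace Λ := by
  rw [mem_expSpace, mem_expSpace, charPoly_eq_mul_removeNth Λ i, mul_comm, map_mul,
    Module.End.mul_apply, aeval_D_X_sub_C]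

theorem exp_mem_expSpace : exp (Λ i) ∈ expSpace Λ := by
  rw [← D_sub_smul_mem_expSpace_iff i, D_exp, sub_self]
  exact zero_mem _

end expSpace

section initialValue

variable {𝕜 : Type*} [RCLike 𝕜] {N : ℕ} (Λ : Fin N → 𝕜)

theorem exists_mem_expSpace_jet_eq (c : ℝ) (v : Fin N → 𝕜) : ∃ f ∈ expSpace Λ, jet N c f = v := by
  induction N with
  | zero => exact ⟨0, zero_mem _, Subsingleton.elim _ _⟩
  | succ N ih =>
    obtain ⟨g, hg, hjet⟩ := ih (Fin.removeNth 0 Λ) fun j ↦ v j.succ - Λ 0 * v j.castSucc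
    obtain ⟨f, rfl, hfc⟩ := exists_D_sub_smul_eq (Λ 0) g c (v 0)
    refine ⟨f, (D_sub_smul_mem_expSpace_iff 0).1 hg, funext fun j ↦ ?_⟩
    induction j using Fin.induction with
    | zero => exact hfc
    | succ j ihj =>
      have hj : jet (N + 1) c f j.succ - Λ 0 * jet (N + 1) c f j.castSucc
          = v j.succ - Λ 0 * v j.castSucc := by
        rw [← congrFun hjet j, map_sub, map_smul]
        change (D ^ ((j : ℕ) + 1)) f c - _ = _
        rw [D_pow_succ_apply]
        rfl
      rwa [ihj, sub_left_inj] at hj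

variable {Λ}

theorem eq_zero_of_mem_vanishingIdeal {f : smoothFun 𝕜} (hf : f ∈ expSpace Λ) {c : ℝ}
    (hc : f ∈ vanishingIdeal c N) : f = 0 := by
  induction N generalizing f with
  | zero => simpa [mem_expSpace, charPoly] using hf
  | succ N ih =>
    obtain ⟨hfc, hD⟩ := mem_vanishingIdeal_succ'.1 hc
    exact eq_zero_of_D_eq_smul (sub_eq_zero.1 (ih ((D_sub_smul_mem_expSpace_iff 0).2 hf)
      (sub_mem hD (Submodule.smul_of_tower_mem _ _ (vanishingIdeal_mono N.le_succ hc))))) hfc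

theorem eq_of_jet_eq {f g : smoothFun 𝕜} (hf : f ∈ expSpace Λ) (hg : g ∈ expSpace Λ) {c : ℝ}
    (h : jet N c f = jet N c g) : f = g :=
  sub_eq_zero.1 <| eq_zero_of_mem_vanishingIdeal (sub_mem hf hg) <|
    jet_eq_zero_iff.1 <| by rw [map_sub, h, sub_self]

variable (Λ)

/-- Cauchy data at the origin determine an exponential polynomial. -/
noncomputable def jetEquiv : expSpace Λ ≃ₗ[𝕜] (Fin N → 𝕜) :=
  LinearEquiv.ofBijective ((jet N 0).domRestrict (expSpace Λ))
    ⟨fun f g h ↦ Subtype.ext (eq_of_jet_eq f.2 g.2 h), fun v ↦ by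
      obtain ⟨f, hf, hv⟩ := exists_mem_expSpace_jet_eq Λ 0 v
      exact ⟨⟨f, hf⟩, hv⟩⟩

instance : FiniteDimensional 𝕜 (expSpace Λ) := (jetEquiv Λ).symm.finiteDimensional

theorem finrank_expSpace : Module.finrank 𝕜 (expSpace Λ) = N := by
  rw [(jetEquiv Λ).finrank_eq, Module.finrank_fin_fun]

end initialValue

section expPoly

variable {N : ℕ}

theorem expDiffOp_eq (Λ : Fin N → ℂ) (f : smoothFun ℂ) :
    expDiffOp Λ f = aeval D (charPoly Λ) f := by
  induction N with
  | zero => simp [expDiffOp, charPoly]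
  | succ N ih =>
    have hsplit : expDiffOp Λ f = fun x ↦ deriv (expDiffOp (Fin.removeNth 0 Λ) f) x
        - Λ 0 * expDiffOp (Fin.removeNth 0 Λ) f x := by
      rw [expDiffOp, List.ofFn_succ, List.foldr_cons]
      rfl
    rw [hsplit, ih, charPoly_eq_mul_removeNth Λ 0, map_mul, Module.End.mul_apply, aeval_D_X_sub_C]
    rfl

theorem coe_mem_expPoly {Λ : Fin N → ℂ} {f : smoothFun ℂ} :
    (f : ℝ → ℂ) ∈ expPoly Λ ↔ f ∈ expSpace Λ := by
  rw [mem_expSpace]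
  refine ⟨fun h ↦ smoothFun.ext fun x ↦ ?_, fun h ↦ ⟨contDiff f, fun x ↦ ?_⟩⟩
  · rw [← expDiffOp_eq, h.2]
    rfl
  · rw [expDiffOp_eq, h]
    rfl

end expPoly

/-! ### Disconjugacy -/

namespace smoothFun

section postcomp

variable {𝕜 𝕜' : Type*} [RCLike 𝕜] [RCLike 𝕜']

/-- Composition of smooth functions with a real-linear map of their values, such as the real part
or complex conjugation. -/
noncomputable def postcomp (φ : 𝕜 →L[ℝ] 𝕜') : smoothFun 𝕜 →ₗ[ℝ] smoothFun 𝕜' where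
  toFun f := ⟨fun x ↦ φ (f x), φ.contDiff.comp (contDiff f)⟩
  map_add' f g := ext fun x ↦ map_add φ (f x) (g x)
  map_smul' r f := ext fun x ↦ map_smul φ r (f x)

theorem D_pow_postcomp (φ : 𝕜 →L[ℝ] 𝕜') (j : ℕ) (f : smoothFun 𝕜) :
    (D ^ j) (postcomp φ f) = postcomp φ ((D ^ j) f) := by
  induction j generalizing f with
  | zero => rfl
  | succ j ih =>
    have hD : D (postcomp φ f) = postcomp φ (D f) :=
      D_eq fun x ↦ φ.hasFDerivAt.comp_hasDerivAt x (hasDerivAt f x)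
    rw [D_pow_succ_apply, hD, ih, D_pow_succ_apply]

theorem D_pow_postcomp_apply (φ : 𝕜 →L[ℝ] 𝕜') (j : ℕ) (f : smoothFun 𝕜) (x : ℝ) :
    (D ^ j) (postcomp φ f) x = φ ((D ^ j) f x) := by
  rw [D_pow_postcomp]
  rfl

theorem postcomp_mem_vanishingIdeal {f : smoothFun 𝕜} {c : ℝ} {i : ℕ} (φ : 𝕜 →L[ℝ] 𝕜')
    (hf : f ∈ vanishingIdeal c i) : postcomp φ f ∈ vanishingIdeal c i := fun j hj ↦ by
  rw [D_pow_postcomp_apply, hf j hj, map_zero]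

theorem aeval_D_postcomp (φ : 𝕜 →L[ℝ] ℝ) (Q : ℝ[X]) (f : smoothFun 𝕜) :
    aeval D Q (postcomp φ f) = postcomp φ (aeval D (Q.map (algebraMap ℝ 𝕜)) f) := by
  have hsmul (r : ℝ) (g : smoothFun 𝕜) : algebraMap ℝ 𝕜 r • g = r • g := algebraMap_smul 𝕜 r g
  simp only [aeval_eq_sum_range, natDegree_map_eq_of_injective (algebraMap ℝ 𝕜).injective,
    coeff_map, LinearMap.sum_apply, LinearMap.smul_apply, map_sum, hsmul, map_smul, D_pow_postcomp]

end postcomp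

section sign

variable {f : smoothFun ℝ} {a b : ℝ} {k j : ℕ}

theorem exists_mem_Ioo_pos (hab : a < b) (hf : f ∈ vanishingIdeal a k) (hk : 0 < (D ^ k) f a) :
    ∃ x ∈ Ioo a b, 0 < f x := by
  have hlead : 0 < (k.factorial : ℝ)⁻¹ • (D ^ k) f a := smul_pos (by positivity) hk
  have hlim := (tendsto_inv_pow_smul hf).mono_left (nhdsGT_le_nhdsNE a)
  obtain ⟨x, hx, hxI⟩ := ((hlim.eventually_const_lt hlead).and (Ioo_mem_nhdsGT hab)).exists
  exact ⟨x, hxI, pos_of_smul_pos_left hx (inv_nonneg.2 (pow_nonneg (sub_pos.2 hxI.1).le _))⟩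

theorem pos_of_exists_pos (hne : ∀ x ∈ Ioo a b, f x ≠ 0) (hpos : ∃ x ∈ Ioo a b, 0 < f x) :
    ∀ x ∈ Ioo a b, 0 < f x := by
  intro x hx
  by_contra! hle
  obtain ⟨x₀, hx₀, hpos₀⟩ := hpos
  obtain ⟨y, hy, hy0⟩ := isPreconnected_Ioo.intermediate_value hx hx₀ (continuous f).continuousOn
    ⟨hle, hpos₀.le⟩
  exact hne y hy hy0

theorem neg_one_pow_mul_D_pow_nonneg (hab : a < b) (hf : f ∈ vanishingIdeal b j)
    (hnonneg : ∀ x ∈ Ioo a b, 0 ≤ f x) : 0 ≤ (-1) ^ j * (D ^ j) f b := by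
  have hlim := ((tendsto_inv_pow_smul hf).mono_left (nhdsLT_le_nhdsNE b)).const_mul ((-1) ^ j)
  have hlead : 0 ≤ (-1) ^ j * ((j.factorial : ℝ)⁻¹ • (D ^ j) f b) := by
    refine ge_of_tendsto hlim ?_
    filter_upwards [Ioo_mem_nhdsLT hab] with x hx
    have hsign : (-1) ^ j * ((x - b) ^ j)⁻¹ = ((b - x) ^ j)⁻¹ := by
      rw [← inv_pow, ← inv_pow, ← mul_pow, neg_one_mul, ← inv_neg, neg_sub]
    rw [smul_eq_mul, ← mul_assoc, hsign]
    exact mul_nonneg (inv_nonneg.2 (pow_nonneg (sub_nonneg.2 hx.2.le) _)) (hnonneg x hx)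
  rw [smul_eq_mul, mul_left_comm] at hlead
  exact nonneg_of_mul_nonneg_right hlead (by positivity)

theorem neg_one_pow_mul_D_pow_pos (hab : a < b) (ha : f ∈ vanishingIdeal a k)
    (hb : f ∈ vanishingIdeal b j) (hzeros : ¬ HasZeros a b f (k + j + 1)) (hk : 0 < (D ^ k) f a) :
    0 < (-1) ^ j * (D ^ j) f b := by
  have hne : ∀ x ∈ Ioo a b, f x ≠ 0 := fun x hx hfx ↦
    hzeros ⟨k, j, {x}, by simp, ha, hb, by simpa using ⟨hx, hfx⟩⟩
  have hpos := pos_of_exists_pos hne (exists_mem_Ioo_pos hab ha hk)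
  have hj : (D ^ j) f b ≠ 0 := fun h0 ↦
    hzeros ⟨k, j + 1, ∅, by simp [add_assoc], ha, mem_vanishingIdeal_succ.2 ⟨hb, h0⟩, by simp⟩
  exact (neg_one_pow_mul_D_pow_nonneg hab hb fun x hx ↦ (hpos x hx).le).lt_of_ne'
    (mul_ne_zero (by simp) hj)

end sign

end smoothFun

section ClosedUnderConj

variable {N : ℕ} {Λ : Fin N → ℂ}

theorem coeff_charPoly_card : (charPoly Λ).coeff N = 1 := by
  rw [← (charPoly_monic Λ).coeff_natDegree, natDegree_charPoly]

theorem coeff_charPoly_eq {f : smoothFun ℂ} (hf : f ∈ expSpace Λ) {c : ℝ} {j : Fin N}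
    (hjet : jet N c f = Pi.single j 1) : (charPoly Λ).coeff j = -(D ^ N) f c := by
  have hsum : ∑ i : Fin N, (charPoly Λ).coeff i * jet N c f i + (D ^ N) f c = 0 := by
    have h := congrArg (fun g : smoothFun ℂ ↦ g c) (mem_expSpace.1 hf)
    simp only [aeval_eq_sum_range, natDegree_charPoly, Finset.sum_range_succ, Finset.sum_range,
      coeff_charPoly_card, one_smul, LinearMap.add_apply, LinearMap.sum_apply,
      LinearMap.smul_apply, AddMemClass.coe_add, AddSubmonoidClass.coe_finsetSum, Pi.add_apply,
      Finset.sum_apply] at h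
    exact h
  rw [hjet, Finset.sum_eq_single j (fun i _ hij ↦ by rw [Pi.single_eq_of_ne hij, mul_zero])
    (by simp), Pi.single_eq_same, mul_one] at hsum
  exact eq_neg_of_add_eq_zero_left hsum

/-- A solution with real Cauchy data equals its conjugate, hence has real derivatives of all
orders, and these recover the coefficients of the operator. -/
theorem map_conj_charPoly (hΛ : ClosedUnderConj (expPoly Λ)) :
    (charPoly Λ).map (starRingEnd ℂ) = charPoly Λ := by
  let conjCLM : ℂ →L[ℝ] ℂ := Complex.conjCLE
  ext j
  rw [coeff_map]
  rcases lt_trichotomy j N with hj | rfl | hj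
  · obtain ⟨f, hf, hjet⟩ := exists_mem_expSpace_jet_eq Λ 0 (Pi.single ⟨j, hj⟩ 1)
    have hconj : postcomp conjCLM f = f := by
      refine eq_of_jet_eq (coe_mem_expPoly.1 (hΛ f (coe_mem_expPoly.2 hf))) hf (c := 0) ?_
      ext i
      have hi : jet N 0 (postcomp conjCLM f) i = conj (jet N 0 f i) :=
        D_pow_postcomp_apply conjCLM i f 0
      rw [hi, hjet, Pi.single_apply, apply_ite conj, map_one, map_zero]
    have hcoeff : (charPoly Λ).coeff j = -(D ^ N) f 0 := coeff_charPoly_eq hf hjet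
    have hreal : conj ((D ^ N) f 0) = (D ^ N) f 0 := by
      conv_rhs => rw [← hconj, D_pow_postcomp_apply]
      rfl
    rw [hcoeff, map_neg, hreal]
  · rw [coeff_charPoly_card, map_one]
  · rw [coeff_eq_zero_of_natDegree_lt (by rwa [natDegree_charPoly]), map_zero]

end ClosedUnderConj

/-- Hypotheses under which `E_Λ` is disconjugate on `[a, b]`: the characteristic polynomial is real
and its roots satisfy `(b - a) |Im z| < π`. -/
structure DisconjugacyCriterion {N : ℕ} (Λ : Fin N → ℂ) (a b : ℝ) : Prop where
  lt : a < b
  map_conj : (charPoly Λ).map (starRingEnd ℂ) = charPoly Λ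
  width : ∀ i, (b - a) * |(Λ i).im| < Real.pi

namespace DisconjugacyCriterion

theorem removeNth {N : ℕ} {Λ : Fin (N + 1) → ℂ} {a b : ℝ} (h : DisconjugacyCriterion Λ a b)
    (i : Fin (N + 1)) (hi : conj (Λ i) = Λ i) : DisconjugacyCriterion (i.removeNth Λ) a b where
  lt := h.lt
  map_conj := by
    have hmap := h.map_conj
    rw [charPoly_eq_mul_removeNth Λ i, Polynomial.map_mul, Polynomial.map_sub, map_X, map_C,
      hi] at hmap
    exact mul_left_cancel₀ (X_sub_C_ne_zero _) hmap
  width j := h.width _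

variable {N : ℕ} {Λ : Fin N → ℂ} {a b : ℝ} (h : DisconjugacyCriterion Λ a b) {f : smoothFun ℂ}
  {i j k : ℕ}

include h

theorem exists_real_charPoly : ∃ Q : ℝ[X], Q.Monic ∧ Q.natDegree = N ∧
    Q.map (algebraMap ℝ ℂ) = charPoly Λ ∧ ∀ z : ℂ, aeval z Q = 0 → (b - a) * |z.im| < Real.pi := by
  have hlifts : charPoly Λ ∈ lifts (algebraMap ℝ ℂ) := (lifts_iff_coeff_lifts _).2 fun j ↦ by
    have hconj : conj ((charPoly Λ).coeff j) = (charPoly Λ).coeff j := by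
      rw [← coeff_map, h.map_conj]
    exact ⟨_, Complex.conj_eq_iff_re.1 hconj⟩
  obtain ⟨Q, hQ, hdeg, hmonic⟩ := lifts_and_natDegree_eq_and_monic hlifts (charPoly_monic Λ)
  refine ⟨Q, hmonic, hdeg.trans (natDegree_charPoly Λ), hQ, fun z hz ↦ ?_⟩
  rw [← eval_map_algebraMap, hQ, charPoly, eval_prod, Finset.prod_eq_zero_iff] at hz
  obtain ⟨i, -, hi⟩ := hz
  rw [eval_sub, eval_X, eval_C, sub_eq_zero] at hi
  exact hi ▸ h.width i

theorem postcomp_eq_zero (φ : ℂ →L[ℝ] ℝ) (hf : f ∈ expSpace Λ)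
    (hzeros : HasZeros a b (postcomp φ f) N) : ∀ x ∈ Icc a b, φ (f x) = 0 := by
  obtain ⟨Q, hQ, rfl, hmap, hroots⟩ := h.exists_real_charPoly
  refine (IsRolleOperator.aeval h.lt hQ hroots).eq_zero hzeros fun x _ ↦ ?_
  rw [aeval_D_postcomp, hmap, mem_expSpace.1 hf, map_zero]
  rfl

theorem eq_zero (hf : f ∈ expSpace Λ) (hij : N ≤ i + j) (ha : f ∈ vanishingIdeal a i)
    (hb : f ∈ vanishingIdeal b j) : f = 0 := by
  have hpart (φ : ℂ →L[ℝ] ℝ) : ∀ x ∈ Icc a b, φ (f x) = 0 := h.postcomp_eq_zero φ hf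
    ⟨i, j, ∅, by simpa using hij, postcomp_mem_vanishingIdeal φ ha,
      postcomp_mem_vanishingIdeal φ hb, by simp⟩
  exact eq_zero_of_mem_vanishingIdeal hf <| mem_vanishingIdeal_of_eqOn_Icc h.lt
    (fun x hx ↦ Complex.ext (hpart Complex.reCLM x hx) (hpart Complex.imCLM x hx))
    (left_mem_Icc.2 h.lt.le) N

/-- Two-point Hermite interpolation. -/
theorem exists_jet_eq_jet_eq (hij : i + j = N) (u : Fin i → ℂ) (v : Fin j → ℂ) :
    ∃ f ∈ expSpace Λ, jet i a f = u ∧ jet j b f = v := by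
  let J : expSpace Λ →ₗ[ℂ] (Fin i → ℂ) × (Fin j → ℂ) :=
    ((jet i a).prod (jet j b)).domRestrict (expSpace Λ)
  have hinj : Function.Injective J := LinearMap.ker_eq_bot.1 <| LinearMap.ker_eq_bot'.2
    fun f hf ↦ Subtype.ext <| h.eq_zero f.2 hij.ge (jet_eq_zero_iff.1 (congrArg Prod.fst hf))
      (jet_eq_zero_iff.1 (congrArg Prod.snd hf))
  have hfinrank : Module.finrank ℂ (expSpace Λ)
      = Module.finrank ℂ ((Fin i → ℂ) × (Fin j → ℂ)) := by
    rw [finrank_expSpace, Module.finrank_prod, Module.finrank_fin_fun, Module.finrank_fin_fun, hij]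
  have hsurj : Function.Surjective J :=
    (LinearMap.injective_iff_surjective_of_finrank_eq_finrank (V := expSpace Λ) hfinrank).1 hinj
  obtain ⟨f, hf⟩ := hsurj (u, v)
  exact ⟨f, f.2, congrArg Prod.fst hf, congrArg Prod.snd hf⟩

theorem D_pow_im_eq_zero (hf : f ∈ expSpace Λ) (hN : k + j + 1 = N) (ha : f ∈ vanishingIdeal a k)
    (hb : f ∈ vanishingIdeal b j) (hk : ((D ^ k) f a).im = 0) : ((D ^ j) f b).im = 0 := by
  have him : postcomp Complex.imCLM f ∈ vanishingIdeal a (k + 1) :=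
    mem_vanishingIdeal_succ.2 ⟨postcomp_mem_vanishingIdeal _ ha, by
      rw [D_pow_postcomp_apply]
      exact hk⟩
  have hzero := h.postcomp_eq_zero Complex.imCLM hf
    ⟨k + 1, j, ∅, by lia, him, postcomp_mem_vanishingIdeal _ hb, by simp⟩
  have hder := mem_vanishingIdeal_of_eqOn_Icc (f := postcomp Complex.imCLM f) h.lt hzero
    (right_mem_Icc.2 h.lt.le) (j + 1) j j.lt_succ_self
  rwa [D_pow_postcomp_apply] at hder

theorem not_hasZeros (hf : f ∈ expSpace Λ) (hk : ((D ^ k) f a).re ≠ 0) :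
    ¬ HasZeros a b (postcomp Complex.reCLM f) N := fun hzeros ↦ hk <| by
  have hder := mem_vanishingIdeal_of_eqOn_Icc (f := postcomp Complex.reCLM f) h.lt
    (h.postcomp_eq_zero Complex.reCLM hf hzeros) (left_mem_Icc.2 h.lt.le) (k + 1) k k.lt_succ_self
  rwa [D_pow_postcomp_apply] at hder

/-- The sign rule: no zeros are left for the interior of the interval, so the leading derivatives
at its endpoints have related signs. -/
theorem exists_pos_D_pow_eq (hf : f ∈ expSpace Λ) (hN : k + j + 1 = N)
    (ha : f ∈ vanishingIdeal a k) (hb : f ∈ vanishingIdeal b j) {v : ℝ} (hv : 0 < v)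
    (hk : (D ^ k) f a = v) : ∃ u : ℝ, 0 < u ∧ (D ^ j) f b = ((-1) ^ j * u : ℝ) := by
  have hre : ((D ^ k) f a).re = v := by rw [hk, Complex.ofReal_re]
  have him : ((D ^ j) f b).im = 0 :=
    h.D_pow_im_eq_zero hf hN ha hb (by rw [hk, Complex.ofReal_im])
  have hpos := neg_one_pow_mul_D_pow_pos (f := postcomp Complex.reCLM f) h.lt
    (postcomp_mem_vanishingIdeal _ ha) (postcomp_mem_vanishingIdeal _ hb)
    (hN ▸ h.not_hasZeros hf (hre ▸ hv.ne')) (by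
      rw [D_pow_postcomp_apply, Complex.reCLM_apply, hre]
      exact hv)
  rw [D_pow_postcomp_apply, Complex.reCLM_apply] at hpos
  refine ⟨_, hpos, Complex.ext ?_ ?_⟩
  · rw [Complex.ofReal_re, ← mul_assoc, ← mul_pow, neg_one_mul, neg_neg, one_pow, one_mul]
  · rw [him, Complex.ofReal_im]

end DisconjugacyCriterion

/-! ### The Bernstein basis -/

/-- The Bernstein basis of `E_Λ` as a family of smooth functions. The exactness of the zeros at the
endpoints is left out: at `a` it follows from the normalization, and at `b` from disconjugacy. -/
structure IsSmoothBernstein {n : ℕ} (Λ : Fin (n + 1) → ℂ) (a b : ℝ)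
    (p : Fin (n + 1) → smoothFun ℂ) : Prop where
  mem (k : Fin (n + 1)) : p k ∈ expSpace Λ
  left (k : Fin (n + 1)) : p k ∈ vanishingIdeal a k
  normalized (k : Fin (n + 1)) : (D ^ (k : ℕ)) (p k) a = 1
  right (k : Fin (n + 1)) : p k ∈ vanishingIdeal b (n - k)

/-- The modulus of the leading derivative of the `k`-th Bernstein function at `b`, whose sign is
`(-1) ^ (n - k)` under a `DisconjugacyCriterion`. -/
noncomputable def endDeriv {n : ℕ} (b : ℝ) (p : Fin (n + 1) → smoothFun ℂ) (k : Fin (n + 1)) : ℝ :=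
  (-1) ^ (n - k : ℕ) * ((D ^ (n - k : ℕ)) (p k) b).re

section existence

variable {n : ℕ} {Λ : Fin (n + 1) → ℂ} {a b : ℝ} (h : DisconjugacyCriterion Λ a b)

include h

theorem DisconjugacyCriterion.exists_isSmoothBernstein : ∃ p, IsSmoothBernstein Λ a b p := by
  have hinterp : ∀ k : Fin (n + 1), ∃ f ∈ expSpace Λ,
      jet (k + 1) a f = Pi.single (Fin.last k) 1 ∧ jet (n - k) b f = 0 :=
    fun k ↦ h.exists_jet_eq_jet_eq (by lia) _ _
  choose p hp ha hb using hinterp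
  refine ⟨p, hp, fun k j hj ↦ ?_, fun k ↦ ?_, fun k ↦ jet_eq_zero_iff.1 (hb k)⟩
  · have hne : (⟨j, hj.trans k.val.lt_succ_self⟩ : Fin (k + 1)) ≠ Fin.last k :=
      Fin.ne_of_lt hj
    exact (congrFun (ha k) _).trans (Pi.single_eq_of_ne hne 1)
  · exact (congrFun (ha k) (Fin.last k)).trans (Pi.single_eq_same _ _)

namespace IsSmoothBernstein

variable {p : Fin (n + 1) → smoothFun ℂ} (hp : IsSmoothBernstein Λ a b p) (k : Fin (n + 1))

include hp

theorem exists_D_pow_eq : ∃ u : ℝ, 0 < u ∧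
    (D ^ (n - k : ℕ)) (p k) b = ((-1) ^ (n - k : ℕ) * u : ℝ) :=
  h.exists_pos_D_pow_eq (hp.mem k) (by lia) (hp.left k) (hp.right k) one_pos
    (by rw [hp.normalized, Complex.ofReal_one])

theorem D_pow_eq :
    (D ^ (n - k : ℕ)) (p k) b = ((-1) ^ (n - k : ℕ) * endDeriv b p k : ℝ) := by
  obtain ⟨u, -, hu⟩ := hp.exists_D_pow_eq h k
  rw [endDeriv, hu, Complex.ofReal_re, ← mul_assoc, ← mul_pow, neg_one_mul, neg_neg, one_pow,
    one_mul]

theorem endDeriv_pos : 0 < endDeriv b p k := by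
  obtain ⟨u, hpos, hu⟩ := hp.exists_D_pow_eq h k
  rwa [endDeriv, hu, Complex.ofReal_re, ← mul_assoc, ← mul_pow, neg_one_mul, neg_neg, one_pow,
    one_mul]

theorem D_pow_ne_zero : (D ^ (n - k : ℕ)) (p k) b ≠ 0 := by
  rw [hp.D_pow_eq h, Complex.ofReal_ne_zero]
  exact mul_ne_zero (by simp) (hp.endDeriv_pos h k).ne'

theorem eq_smul {f : smoothFun ℂ} (hf : f ∈ expSpace Λ) (ha : f ∈ vanishingIdeal a k)
    (hb : f ∈ vanishingIdeal b (n - k)) : f = (D ^ (k : ℕ)) f a • p k := by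
  refine sub_eq_zero.1 (h.eq_zero (sub_mem hf (Submodule.smul_mem _ _ (hp.mem k)))
    (show n + 1 ≤ (k + 1) + (n - k) by lia) (mem_vanishingIdeal_succ.2 ⟨?_, ?_⟩) ?_)
  · exact sub_mem ha (Submodule.smul_of_tower_mem _ _ (hp.left k))
  · rw [D_pow_sub_apply, D_pow_smul_apply, hp.normalized, mul_one, sub_self]
  · exact sub_mem hb (Submodule.smul_of_tower_mem _ _ (hp.right k))

theorem D_pow_eq_mul {f : smoothFun ℂ} (hf : f ∈ expSpace Λ) (ha : f ∈ vanishingIdeal a k)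
    (hb : f ∈ vanishingIdeal b (n - k)) : (D ^ (n - k : ℕ)) f b =
      (D ^ (k : ℕ)) f a * ((-1) ^ (n - k : ℕ) * endDeriv b p k : ℝ) := by
  conv_lhs => rw [hp.eq_smul h k hf ha hb, D_pow_smul_apply, hp.D_pow_eq h k]

protected theorem eq {q : Fin (n + 1) → smoothFun ℂ} (hq : IsSmoothBernstein Λ a b q) : q = p :=
  funext fun k ↦ by
    rw [hp.eq_smul h k (hq.mem k) (hq.left k) (hq.right k), hq.normalized, one_smul]

theorem isBernsteinBasis : IsBernsteinBasis Λ a b fun k ↦ p k := fun k ↦ by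
  simp only [HasZeroOfOrder, ← coe_D_pow]
  exact ⟨coe_mem_expPoly.2 (hp.mem k),
    ⟨hp.left k, by rw [hp.normalized]; exact one_ne_zero⟩,
    ⟨hp.right k, hp.D_pow_ne_zero h k⟩, hp.normalized k⟩

end IsSmoothBernstein

omit h in
theorem IsBernsteinBasis.exists_isSmoothBernstein {P : Fin (n + 1) → ℝ → ℂ}
    (hP : IsBernsteinBasis Λ a b P) : ∃ p, IsSmoothBernstein Λ a b p ∧ P = fun k ↦ ⇑(p k) := by
  let p (k : Fin (n + 1)) : smoothFun ℂ := ⟨P k, (hP k).1.1⟩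
  have hD (j : ℕ) (k : Fin (n + 1)) (x : ℝ) : (D ^ j) (p k) x = iteratedDeriv j (P k) x :=
    congrFun (coe_D_pow j (p k)) x
  exact ⟨p, {
    mem := fun k ↦ coe_mem_expPoly.1 (hP k).1
    left := fun k j hj ↦ (hD j k a).trans ((hP k).2.1.1 j hj)
    normalized := fun k ↦ (hD k k a).trans (hP k).2.2.2
    right := fun k j hj ↦ (hD j k b).trans ((hP k).2.2.1.1 j hj) }, rfl⟩

theorem DisconjugacyCriterion.existsUnique_isBernsteinBasis :
    ∃! p, IsBernsteinBasis Λ a b p := by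
  obtain ⟨p, hp⟩ := h.exists_isSmoothBernstein
  refine ⟨_, hp.isBernsteinBasis h, fun P hP ↦ ?_⟩
  obtain ⟨q, hq, rfl⟩ := hP.exists_isSmoothBernstein
  rw [hp.eq h hq]

theorem DisconjugacyCriterion.exists_bernsteinBasis_eq :
    ∃ p, IsSmoothBernstein Λ a b p ∧ bernsteinBasis Λ a b = fun k ↦ ⇑(p k) :=
  (Classical.epsilon_spec h.existsUnique_isBernsteinBasis.exists).exists_isSmoothBernstein

end existence

section coefficients

variable {n : ℕ} {Λ : Fin (n + 1) → ℂ} {a b : ℝ} {p : Fin (n + 1) → smoothFun ℂ}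
  (β : Fin (n + 1) → ℂ) {s : Finset (Fin (n + 1))} {k : Fin (n + 1)}

namespace IsSmoothBernstein

variable (hp : IsSmoothBernstein Λ a b p)

include hp

theorem sum_mem_vanishingIdeal_left {i : ℕ} (hs : ∀ l ∈ s, i ≤ l) :
    ∑ l ∈ s, β l • p l ∈ vanishingIdeal a i :=
  sum_mem fun l hl ↦ Submodule.smul_of_tower_mem _ _ (vanishingIdeal_mono (hs l hl) (hp.left l))

theorem sum_mem_vanishingIdeal_right {i : ℕ} (hs : ∀ l ∈ s, i ≤ n - l) :
    ∑ l ∈ s, β l • p l ∈ vanishingIdeal b i :=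
  sum_mem fun l hl ↦ Submodule.smul_of_tower_mem _ _ (vanishingIdeal_mono (hs l hl) (hp.right l))

theorem D_pow_sum_left (hk : k ∈ s) (hs : ∀ l ∈ s, k ≤ l) :
    (D ^ (k : ℕ)) (∑ l ∈ s, β l • p l) a = β k := by
  have hrest : (D ^ (k : ℕ)) (∑ l ∈ s.erase k, β l • p l) a = 0 :=
    hp.sum_mem_vanishingIdeal_left (i := k + 1) β
      (fun l hl ↦ Fin.lt_def.1 ((hs l (Finset.mem_of_mem_erase hl)).lt_of_ne'
        (Finset.ne_of_mem_erase hl))) k k.val.lt_succ_self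
  rw [← Finset.add_sum_erase s _ hk, map_add, map_smul]
  change β k * (D ^ (k : ℕ)) (p k) a + (D ^ (k : ℕ)) (∑ l ∈ s.erase k, β l • p l) a = β k
  rw [hrest, hp.normalized, mul_one, add_zero]

theorem D_pow_sum_right (hk : k ∈ s) (hs : ∀ l ∈ s, l ≤ k) :
    (D ^ (n - k : ℕ)) (∑ l ∈ s, β l • p l) b = β k * (D ^ (n - k : ℕ)) (p k) b := by
  have hrest : (D ^ (n - k : ℕ)) (∑ l ∈ s.erase k, β l • p l) b = 0 :=
    hp.sum_mem_vanishingIdeal_right (i := n - k + 1) β (fun l hl ↦ by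
      have hlt : l < k := (hs l (Finset.mem_of_mem_erase hl)).lt_of_ne (Finset.ne_of_mem_erase hl)
      lia) _ (Nat.lt_succ_self _)
  rw [← Finset.add_sum_erase s _ hk, map_add, map_smul]
  change _ + (D ^ (n - k : ℕ)) (∑ l ∈ s.erase k, β l • p l) b = _
  rw [hrest, add_zero]
  rfl

theorem linearIndependent : LinearIndependent ℂ p := by
  refine Fintype.linearIndependent_iff.2 fun β hβ ↦ ?_
  by_contra! hne
  have hsupp : (Finset.univ.filter fun l ↦ β l ≠ 0).Nonempty := by
    simpa only [Finset.filter_nonempty_iff, Finset.mem_univ, true_and] using hne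
  have hmin := Finset.min'_mem _ hsupp
  refine (Finset.mem_filter.1 hmin).2 ?_
  rw [← hp.D_pow_sum_left β hmin fun l hl ↦ Finset.min'_le _ l hl,
    Finset.sum_filter_of_ne fun l _ hl ↦ left_ne_zero_of_smul hl, hβ, map_zero]
  rfl

theorem exists_sum_eq {f : smoothFun ℂ} (hf : f ∈ expSpace Λ) :
    ∃ β : Fin (n + 1) → ℂ, ∑ l, β l • p l = f := by
  have hspan : Submodule.span ℂ (Set.range p) = expSpace Λ := by
    refine Submodule.eq_of_le_of_finrank_eq (Submodule.span_le.2 ?_) ?_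
    · rintro _ ⟨k, rfl⟩
      exact hp.mem k
    · rw [finrank_span_eq_card hp.linearIndependent, finrank_expSpace, Fintype.card_fin]
  rwa [← hspan, Submodule.mem_span_range_iff_exists_fun] at hf

theorem coeff_unique (hab : a < b) {β γ : Fin (n + 1) → ℂ}
    (h : ∀ x ∈ Icc a b, ∑ l, β l * p l x = ∑ l, γ l * p l x) : β = γ := by
  have hvanish : ∀ x ∈ Icc a b, (∑ l, (β l - γ l) • p l : smoothFun ℂ) x = 0 := fun x hx ↦ by
    rw [AddSubmonoidClass.coe_finsetSum, Finset.sum_apply]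
    change ∑ l, (β l - γ l) * p l x = 0
    simp only [sub_mul, Finset.sum_sub_distrib, h x hx, sub_self]
  have hzero : ∑ l, (β l - γ l) • p l = 0 := eq_zero_of_mem_vanishingIdeal
    (sum_mem fun l _ ↦ Submodule.smul_mem _ _ (hp.mem l))
    (mem_vanishingIdeal_of_eqOn_Icc hab hvanish (left_mem_Icc.2 hab.le) _)
  exact funext fun l ↦ sub_eq_zero.1
    (Fintype.linearIndependent_iff.1 hp.linearIndependent (fun l ↦ β l - γ l) hzero l)

end IsSmoothBernstein

end coefficients

/-! ### The coefficients of an exponential -/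

section exponential

variable {m : ℕ} {Λ : Fin (m + 2) → ℂ} {a b : ℝ} {i : Fin (m + 2)}
  {p : Fin (m + 2) → smoothFun ℂ} {q : Fin (m + 1) → smoothFun ℂ} {β : Fin (m + 2) → ℂ}

namespace IsSmoothBernstein

variable (hp : IsSmoothBernstein Λ a b p)

include hp

theorem coeff_zero : β 0 = (∑ l, β l • p l : smoothFun ℂ) a :=
  (hp.D_pow_sum_left β (Finset.mem_univ 0) fun l _ ↦ Fin.zero_le l).symm

theorem coeff_last_mul_endDeriv (h : DisconjugacyCriterion Λ a b) :
    β (Fin.last (m + 1)) * endDeriv b p (Fin.last (m + 1)) =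
      (∑ l, β l • p l : smoothFun ℂ) b := by
  have hlast := hp.D_pow_sum_right β (Finset.mem_univ (Fin.last (m + 1))) fun l _ ↦ Fin.le_last l
  rw [hp.D_pow_eq h, Fin.val_last, Nat.sub_self, pow_zero, pow_zero, one_mul] at hlast
  exact hlast.symm

/-- Cut the sum after its `k`-th term. Applying `d/dx - Λ i` to the two parts gives, up to sign,
the same element of `E_Λ` without `Λ i`; its order of vanishing at `a` is read off the upper part
and that at `b` off the lower part, so it is a multiple of `q k`. -/
theorem coeff_succ_mul_endDeriv (h : DisconjugacyCriterion Λ a b)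
    (hi : DisconjugacyCriterion (i.removeNth Λ) a b) (hq : IsSmoothBernstein (i.removeNth Λ) a b q)
    (hβ : D (∑ l, β l • p l) = Λ i • ∑ l, β l • p l) (k : Fin (m + 1)) :
    β k.succ * endDeriv b q k = β k.castSucc * endDeriv b p k.castSucc := by
  set F := ∑ l ∈ Finset.Iic k.castSucc, β l • p l
  set G := ∑ l ∈ (Finset.Iic k.castSucc)ᶜ, β l • p l
  have hcompl {l : Fin (m + 2)} : l ∈ (Finset.Iic k.castSucc)ᶜ ↔ k.succ ≤ l := by
    rw [Finset.mem_compl, Finset.mem_Iic, not_le, Fin.castSucc_lt_iff_succ_le]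
  have hFb : F ∈ vanishingIdeal b (m - k + 1) :=
    hp.sum_mem_vanishingIdeal_right β fun l hl ↦ by
      have hle : (l : ℕ) ≤ k := Fin.le_def.1 (Finset.mem_Iic.1 hl)
      lia
  have hGa : G ∈ vanishingIdeal a (k + 1) :=
    hp.sum_mem_vanishingIdeal_left β fun l hl ↦ hcompl.1 hl
  have hcut : D F - Λ i • F = -(D G - Λ i • G) := by
    rw [← Finset.sum_add_sum_compl (Finset.Iic k.castSucc), map_add, smul_add] at hβ
    rw [neg_sub, sub_eq_sub_iff_add_eq_add, add_comm (Λ i • G), hβ, add_comm]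
  have hmem : D F - Λ i • F ∈ expSpace (i.removeNth Λ) :=
    (D_sub_smul_mem_expSpace_iff i).2 (sum_mem fun l _ ↦ Submodule.smul_mem _ _ (hp.mem l))
  have ha : D F - Λ i • F ∈ vanishingIdeal a k :=
    hcut ▸ neg_mem (D_sub_smul_mem_vanishingIdeal _ hGa)
  have hleft : (D ^ (k : ℕ)) (D F - Λ i • F) a = -β k.succ := by
    rw [hcut, map_neg]
    exact congrArg Neg.neg ((D_pow_D_sub_smul _ hGa).trans
      (hp.D_pow_sum_left β (hcompl.2 le_rfl) fun l ↦ hcompl.1))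
  have hright : (D ^ (m - k : ℕ)) (D F - Λ i • F) b =
      β k.castSucc * ((-1) ^ (m - k + 1 : ℕ) * endDeriv b p k.castSucc : ℝ) := by
    have hk : m + 1 - (k.castSucc : ℕ) = m - k + 1 := Nat.succ_sub k.is_le
    rw [D_pow_D_sub_smul _ hFb, ← hk, hp.D_pow_sum_right β (Finset.mem_Iic.2 le_rfl)
      fun l ↦ Finset.mem_Iic.1, hp.D_pow_eq h]
  have hq' := hq.D_pow_eq_mul hi k hmem ha (D_sub_smul_mem_vanishingIdeal _ hFb)
  rw [hleft, hright] at hq'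
  push_cast at hq'
  have hsign : (-1 : ℂ) ^ (m - k : ℕ) ≠ 0 := by simp
  refine mul_left_cancel₀ hsign ?_
  linear_combination hq'

end IsSmoothBernstein

theorem coe_exp_ofReal (l : ℝ) : ⇑(exp (l : ℂ)) = expFun l := funext fun x ↦ by
  rw [exp_apply, ← Complex.exp_eq_exp_ℂ, expFun, Complex.real_smul, ← Complex.ofReal_mul,
    mul_comm, Complex.ofReal_exp]

/-- `x` is the family of coefficients of `e^{l ·}` in the Bernstein basis `p`, and it is
positive. -/
structure IsExpCoeff (p : Fin (m + 2) → smoothFun ℂ) (l : ℝ) (x : Fin (m + 2) → ℝ) : Prop where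
  pos (k : Fin (m + 2)) : 0 < x k
  sum_eq : ∑ k, (x k : ℂ) • p k = exp (l : ℂ)

variable {l : ℝ}

theorem IsSmoothBernstein.exists_isExpCoeff (hp : IsSmoothBernstein Λ a b p)
    (h : DisconjugacyCriterion Λ a b) (hi : DisconjugacyCriterion (i.removeNth Λ) a b)
    (hq : IsSmoothBernstein (i.removeNth Λ) a b q) (hl : Λ i = l) : ∃ x, IsExpCoeff p l x := by
  obtain ⟨β, hβ⟩ := hp.exists_sum_eq (hl ▸ exp_mem_expSpace (Λ := Λ) i)
  have hpos : ∀ k, ∃ x : ℝ, 0 < x ∧ β k = x := fun k ↦ by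
    induction k using Fin.induction with
    | zero => exact ⟨_, Real.exp_pos _, by rw [hp.coeff_zero (β := β), hβ, coe_exp_ofReal, expFun]⟩
    | succ k ih =>
      obtain ⟨x, hx, hxk⟩ := ih
      have hQ := hq.endDeriv_pos hi k
      refine ⟨x * endDeriv b p k.castSucc / endDeriv b q k,
        div_pos (mul_pos hx (hp.endDeriv_pos h _)) hQ, ?_⟩
      have hsucc := hp.coeff_succ_mul_endDeriv h hi hq (by rw [hβ, D_exp, hl]) k
      rw [Complex.ofReal_div, eq_div_iff (Complex.ofReal_ne_zero.2 hQ.ne'), hsucc, hxk,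
        Complex.ofReal_mul]
  choose x hx hβx using hpos
  obtain rfl : β = fun k ↦ (x k : ℂ) := funext hβx
  exact ⟨x, hx, hβ⟩

namespace IsExpCoeff

variable {x : Fin (m + 2) → ℝ} (hx : IsExpCoeff p l x) (hp : IsSmoothBernstein Λ a b p)

include hx hp

theorem apply_zero : x 0 = Real.exp (l * a) := by
  have hzero := hp.coeff_zero (β := fun k ↦ (x k : ℂ))
  rw [hx.sum_eq, coe_exp_ofReal] at hzero
  exact Complex.ofReal_injective hzero

theorem apply_last_mul_endDeriv (h : DisconjugacyCriterion Λ a b) :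
    x (Fin.last (m + 1)) * endDeriv b p (Fin.last (m + 1)) = Real.exp (l * b) := by
  have hlast := hp.coeff_last_mul_endDeriv (β := fun k ↦ (x k : ℂ)) h
  rw [hx.sum_eq, coe_exp_ofReal, expFun] at hlast
  exact_mod_cast hlast

theorem apply_succ_mul_endDeriv (h : DisconjugacyCriterion Λ a b)
    (hi : DisconjugacyCriterion (i.removeNth Λ) a b) (hl : Λ i = l)
    (hq : IsSmoothBernstein (i.removeNth Λ) a b q) (k : Fin (m + 1)) :
    x k.succ * endDeriv b q k = x k.castSucc * endDeriv b p k.castSucc := by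
  have hsucc := hp.coeff_succ_mul_endDeriv (β := fun k ↦ (x k : ℂ)) h hi hq
    (by rw [hx.sum_eq, D_exp, hl]) k
  exact_mod_cast hsucc

end IsExpCoeff

end exponential

/-! ### Comparison of the two subspaces -/

section comparison

variable {m : ℕ} {Λ : Fin (m + 2) → ℂ} {a b : ℝ}
  {p : Fin (m + 2) → smoothFun ℂ} {q r : Fin (m + 1) → smoothFun ℂ}

namespace IsSmoothBernstein

theorem sub_eq_smul {i j : Fin (m + 2)} (hp : IsSmoothBernstein Λ a b p)
    (hq : IsSmoothBernstein (i.removeNth Λ) a b q) (hr : IsSmoothBernstein (j.removeNth Λ) a b r)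
    (h : DisconjugacyCriterion Λ a b) (hi : DisconjugacyCriterion (i.removeNth Λ) a b)
    (hj : DisconjugacyCriterion (j.removeNth Λ) a b) (k : Fin (m + 1)) :
    q k - r k = (((endDeriv b q k - endDeriv b r k) / endDeriv b p k.succ : ℝ) : ℂ) • p k.succ := by
  have hk : m + 1 - (k.succ : ℕ) = m - k := Nat.add_sub_add_right m 1 k
  have hmem : q k - r k ∈ expSpace Λ :=
    sub_mem (removeNth_mem_expSpace i (hq.mem k)) (removeNth_mem_expSpace j (hr.mem k))
  have ha : q k - r k ∈ vanishingIdeal a k.succ := by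
    refine mem_vanishingIdeal_succ.2 ⟨sub_mem (hq.left k) (hr.left k), ?_⟩
    rw [D_pow_sub_apply, hq.normalized, hr.normalized, sub_self]
  have hb : q k - r k ∈ vanishingIdeal b (m + 1 - (k.succ : ℕ)) :=
    hk ▸ sub_mem (hq.right k) (hr.right k)
  have hcoeff : endDeriv b q k - endDeriv b r k =
      (D ^ (k.succ : ℕ)) (q k - r k) a * endDeriv b p k.succ := by
    have hmul := hp.D_pow_eq_mul h k.succ hmem ha hb
    rw [hk, D_pow_sub_apply, hq.D_pow_eq hi, hr.D_pow_eq hj] at hmul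
    push_cast at hmul
    have hsign : (-1 : ℂ) ^ (m - k : ℕ) ≠ 0 := by simp
    refine mul_left_cancel₀ hsign ?_
    linear_combination hmul
  have hP : (endDeriv b p k.succ : ℂ) ≠ 0 := Complex.ofReal_ne_zero.2 (hp.endDeriv_pos h _).ne'
  rw [Complex.ofReal_div, Complex.ofReal_sub, hcoeff, mul_div_cancel_right₀ _ hP]
  exact hp.eq_smul h k.succ hmem ha hb

end IsSmoothBernstein

/-- The combination `(d/dx - l₀) f - (d/dx - l₁) g`, for comparing an `f` in the space without `l₁`
with a `g` in the space without `l₀`: it lies in the space without both. -/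
noncomputable def crossDiff (l₀ l₁ : ℝ) (f g : smoothFun ℂ) : smoothFun ℂ :=
  (D f - (l₀ : ℂ) • f) - (D g - (l₁ : ℂ) • g)

variable {l₀ l₁ : ℝ}

theorem crossDiff_mem_expSpace (h₀ : Λ 0 = l₀) (h₁ : Λ 1 = l₁) {f g : smoothFun ℂ}
    (hf : f ∈ expSpace (Fin.removeNth 1 Λ)) (hg : g ∈ expSpace (Fin.removeNth 0 Λ)) :
    crossDiff l₀ l₁ f g ∈ expSpace (Fin.removeNth 0 (Fin.removeNth 1 Λ)) := by
  rw [crossDiff, ← h₀, ← h₁]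
  exact sub_mem ((D_sub_smul_mem_expSpace_iff (Λ := Fin.removeNth 1 Λ) 0).2 hf)
    ((D_sub_smul_mem_expSpace_iff (Λ := Fin.removeNth 0 Λ) 0).2 hg)

namespace IsSmoothBernstein

variable (hq : IsSmoothBernstein (Fin.removeNth 0 Λ) a b q)
  (hr : IsSmoothBernstein (Fin.removeNth 1 Λ) a b r) {k : Fin (m + 1)}

include hq hr

theorem crossDiff_left (hp : IsSmoothBernstein Λ a b p) {δ : ℝ}
    (hδ : q k - r k = (δ : ℂ) • p k.succ) :
    crossDiff l₀ l₁ (r k) (q k) ∈ vanishingIdeal a k ∧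
      (D ^ (k : ℕ)) (crossDiff l₀ l₁ (r k) (q k)) a = (l₁ - l₀ - δ : ℝ) := by
  have heq : crossDiff l₀ l₁ (r k) (q k) =
      (l₁ : ℂ) • q k - (l₀ : ℂ) • r k - (δ : ℂ) • D (p k.succ) := by
    rw [crossDiff, ← map_smul, ← hδ, map_sub]
    abel
  have hDp : D (p k.succ) ∈ vanishingIdeal a k := D_mem_vanishingIdeal (hp.left k.succ)
  have hDpk : (D ^ (k : ℕ)) (D (p k.succ)) a = 1 := by
    rw [← D_pow_succ_apply]
    exact hp.normalized k.succ
  rw [heq]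
  constructor
  · exact sub_mem (sub_mem (Submodule.smul_of_tower_mem _ _ (hq.left k))
      (Submodule.smul_of_tower_mem _ _ (hr.left k))) (Submodule.smul_of_tower_mem _ _ hDp)
  · simp only [D_pow_sub_apply, D_pow_smul_apply, hq.normalized, hr.normalized, hDpk, mul_one,
      Complex.ofReal_sub]

theorem crossDiff_right (h₀ : DisconjugacyCriterion (Fin.removeNth 0 Λ) a b)
    (h₁ : DisconjugacyCriterion (Fin.removeNth 1 Λ) a b) {j : ℕ} (hj : m - k = j + 1) :
    crossDiff l₀ l₁ (r k) (q k) ∈ vanishingIdeal b j ∧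
      (D ^ j) (crossDiff l₀ l₁ (r k) (q k)) b =
        ((-1) ^ j * (endDeriv b q k - endDeriv b r k) : ℝ) := by
  have hqb := hq.right k
  have hrb := hr.right k
  rw [hj] at hqb hrb
  refine ⟨sub_mem (D_sub_smul_mem_vanishingIdeal _ hrb) (D_sub_smul_mem_vanishingIdeal _ hqb), ?_⟩
  rw [crossDiff, D_pow_sub_apply, D_pow_D_sub_smul _ hrb, D_pow_D_sub_smul _ hqb, ← hj,
    hr.D_pow_eq h₁, hq.D_pow_eq h₀, hj]
  push_cast
  ring

/-- If the inequality failed, `crossDiff l₀ l₁ (r k) (q k)` would have a positive leading derivative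
at `a`, so that the sign rule would determine the sign of its leading derivative at `b`; but the
latter is, up to the same sign, the difference of the two sides. -/
theorem endDeriv_lt (hp : IsSmoothBernstein Λ a b p) (h : DisconjugacyCriterion Λ a b)
    (h₀ : Λ 0 = l₀) (h₁ : Λ 1 = l₁) (hlt : l₀ < l₁) : endDeriv b r k < endDeriv b q k := by
  have hd₀ := h.removeNth 0 (by rw [h₀, Complex.conj_ofReal])
  have hd₁ := h.removeNth 1 (by rw [h₁, Complex.conj_ofReal])
  have hd := hd₁.removeNth 0 (show conj (Λ 0) = Λ 0 by rw [h₀, Complex.conj_ofReal])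
  have hmem := crossDiff_mem_expSpace h₀ h₁ (hr.mem k) (hq.mem k)
  obtain ⟨ha, hak⟩ := crossDiff_left (l₀ := l₀) (l₁ := l₁) hq hr hp
    (hp.sub_eq_smul hq hr h hd₀ hd₁ k)
  by_contra! hle
  have hpos := calc
    0 < l₁ - l₀ := sub_pos.2 hlt
    _ ≤ l₁ - l₀ - (endDeriv b q k - endDeriv b r k) / endDeriv b p k.succ :=
      le_sub_self_iff _ |>.2 <|
        div_nonpos_of_nonpos_of_nonneg (sub_nonpos.2 hle) (hp.endDeriv_pos h _).le
  rcases hj : m - k with _ | j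
  · have hzero := hd.eq_zero hmem (show m ≤ k + 0 by lia) ha mem_vanishingIdeal_zero
    rw [hzero, map_zero] at hak
    exact hpos.ne (Complex.ofReal_injective hak)
  · obtain ⟨hb, hbj⟩ := crossDiff_right (l₀ := l₀) (l₁ := l₁) hq hr hd₀ hd₁ hj
    obtain ⟨u, hu, hbu⟩ :=
      hd.exists_pos_D_pow_eq hmem (show k + j + 1 = m by lia) ha hb hpos hak
    have hu_eq : u = endDeriv b q k - endDeriv b r k :=
      mul_left_cancel₀ (by simp) (Complex.ofReal_injective (hbu.symm.trans hbj))
    exact hu.not_ge (hu_eq ▸ sub_nonpos.2 hle)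

end IsSmoothBernstein

end comparison

/-! ### Nodes and weights -/

section twoExponentials

variable {l₀ l₁ : ℝ}

theorem exists_mul_exp_eq (hl : l₀ < l₁) {x y : ℝ} (hx : 0 < x) (hy : 0 < y) :
    ∃ t α : ℝ, α * Real.exp (l₀ * t) = x ∧ α * Real.exp (l₁ * t) = y := by
  refine ⟨Real.log (y / x) / (l₁ - l₀), x * Real.exp (-(l₀ * (Real.log (y / x) / (l₁ - l₀)))),
    ?_, ?_⟩
  · rw [mul_assoc, ← Real.exp_add, neg_add_cancel, Real.exp_zero, mul_one]
  · rw [mul_assoc, ← Real.exp_add, ← neg_mul, ← add_mul, neg_add_eq_sub,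
      mul_div_cancel₀ _ (sub_pos.2 hl).ne', Real.exp_log (div_pos hy hx), mul_div_cancel₀ _ hx.ne']

theorem eq_and_eq_of_mul_exp_eq (hl : l₀ < l₁) {t t' α α' : ℝ} (hα : α ≠ 0)
    (h₀ : α' * Real.exp (l₀ * t') = α * Real.exp (l₀ * t))
    (h₁ : α' * Real.exp (l₁ * t') = α * Real.exp (l₁ * t)) : t' = t ∧ α' = α := by
  have hα' : α' ≠ 0 := by
    rintro rfl
    rw [zero_mul] at h₀
    exact mul_ne_zero hα (Real.exp_ne_zero _) h₀.symm
  have hexp : Real.exp (l₁ * t' + l₀ * t) = Real.exp (l₁ * t + l₀ * t') := by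
    refine mul_left_cancel₀ (mul_ne_zero hα' hα) ?_
    rw [Real.exp_add, Real.exp_add]
    linear_combination α * Real.exp (l₀ * t) * h₁ - α * Real.exp (l₁ * t) * h₀
  have ht : t' = t := by
    refine mul_left_cancel₀ (sub_pos.2 hl).ne' ?_
    linear_combination Real.exp_injective hexp
  exact ⟨ht, mul_right_cancel₀ (Real.exp_ne_zero _) (ht ▸ h₀)⟩

end twoExponentials

theorem eq_neg_one_pow_mul_prod {R : Type*} [CommRing R] {n : ℕ} {f : Fin (n + 1) → R}
    {d : Fin n → R} (hf : ∀ k, f k.succ = -(d k * f k.castSucc)) (k : Fin (n + 1)) :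
    f k = (-1) ^ (k : ℕ) * (∏ l with l.castSucc < k, d l) * f 0 := by
  induction k using Fin.induction with
  | zero => simp
  | succ k ih =>
    have hfilter : Finset.univ.filter (fun l : Fin n ↦ l.castSucc < k.succ) =
        insert k (Finset.univ.filter fun l : Fin n ↦ l.castSucc < k.castSucc) := by
      ext l
      simp only [Finset.mem_filter, Finset.mem_univ, true_and, Finset.mem_insert,
        Fin.castSucc_lt_succ_iff, Fin.castSucc_lt_castSucc_iff, le_iff_eq_or_lt]
    rw [hfilter, Finset.prod_insert (by simp), hf, ih, Fin.val_succ, Fin.val_castSucc, pow_succ]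
    ring

namespace IsSmoothBernstein

theorem tendsto_div {n : ℕ} {Λ Λ' : Fin (n + 1) → ℂ} {a b : ℝ} {q r : Fin (n + 1) → smoothFun ℂ}
    (hq : IsSmoothBernstein Λ a b q) (hr : IsSmoothBernstein Λ' a b r)
    (h : DisconjugacyCriterion Λ a b) (h' : DisconjugacyCriterion Λ' a b) (k : Fin (n + 1)) :
    Tendsto (fun x ↦ r k x / q k x) (𝓝[≠] b) (𝓝 (endDeriv b r k / endDeriv b q k : ℝ)) := by
  have hlim := smoothFun.tendsto_div (hr.right k) (hq.right k) (hq.D_pow_ne_zero h k)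
  rwa [hq.D_pow_eq h, hr.D_pow_eq h', ← Complex.ofReal_div,
    mul_div_mul_left _ _ (by simp)] at hlim

theorem tendsto_deriv_div {n : ℕ} {Λ : Fin (n + 2) → ℂ} {Λ' : Fin (n + 1) → ℂ} {a b : ℝ}
    {p : Fin (n + 2) → smoothFun ℂ} {q : Fin (n + 1) → smoothFun ℂ}
    (hp : IsSmoothBernstein Λ a b p) (hq : IsSmoothBernstein Λ' a b q)
    (h : DisconjugacyCriterion Λ a b) (h' : DisconjugacyCriterion Λ' a b) (k : Fin (n + 1)) :
    Tendsto (fun x ↦ deriv (p k.castSucc) x / q k x) (𝓝[≠] b)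
      (𝓝 (-(endDeriv b p k.castSucc / endDeriv b q k) : ℝ)) := by
  have hk : n + 1 - (k.castSucc : ℕ) = n - k + 1 := Nat.succ_sub k.is_le
  have hright := hp.right k.castSucc
  have hlead := hp.D_pow_eq h k.castSucc
  rw [hk] at hright hlead
  have hderiv : D (p k.castSucc) ∈ vanishingIdeal b (n - k : ℕ) := D_mem_vanishingIdeal hright
  have hlim := smoothFun.tendsto_div hderiv (hq.right k) (hq.D_pow_ne_zero h' k)
  rwa [← D_pow_succ_apply, hlead, hq.D_pow_eq h', ← Complex.ofReal_div, pow_succ, mul_assoc,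
    mul_div_mul_left _ _ (by simp), neg_one_mul, neg_div] at hlim

end IsSmoothBernstein

section bernsteinOp

variable {m : ℕ} {Λ : Fin (m + 2) → ℂ} {a b l : ℝ} {p : Fin (m + 2) → smoothFun ℂ}
  {t α x : Fin (m + 2) → ℝ} (hB : bernsteinBasis Λ a b = fun k ↦ ⇑(p k))

include hB

theorem bernsteinOp_expFun_apply (c : ℝ) : bernsteinOp Λ a b t α (expFun l) c =
    ∑ k, ((α k * Real.exp (l * t k) : ℝ) : ℂ) * p k c := by
  simp only [bernsteinOp, hB, expFun, Complex.ofReal_mul]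

theorem bernsteinOp_expFun_eq (h : IsExpCoeff p l fun k ↦ α k * Real.exp (l * t k)) :
    bernsteinOp Λ a b t α (expFun l) = expFun l := by
  funext c
  rw [bernsteinOp_expFun_apply hB, ← coe_exp_ofReal, ← h.sum_eq,
    AddSubmonoidClass.coe_finsetSum, Finset.sum_apply]
  rfl

theorem IsExpCoeff.eq_of_bernsteinOp_expFun (hx : IsExpCoeff p l x)
    (hp : IsSmoothBernstein Λ a b p) (hab : a < b)
    (h : ∀ c ∈ Icc a b, bernsteinOp Λ a b t α (expFun l) c = expFun l c) (k : Fin (m + 2)) :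
    α k * Real.exp (l * t k) = x k := by
  have hcoeff := hp.coeff_unique (β := fun k ↦ ((α k * Real.exp (l * t k) : ℝ) : ℂ))
    (γ := fun k ↦ (x k : ℂ)) hab fun c hc ↦ ?_
  · exact Complex.ofReal_injective (congrFun hcoeff k)
  rw [← bernsteinOp_expFun_apply hB, h c hc, ← coe_exp_ofReal, ← hx.sum_eq,
    AddSubmonoidClass.coe_finsetSum, Finset.sum_apply]
  rfl

end bernsteinOp

/-- The nodes `t` and the weights `α` of an operator `f ↦ ∑ k, α k * f (t k) * p k` fixing
`e^{l₀ ·}` and `e^{l₁ ·}`, where `IsExpCoeff` makes the weights positive. -/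
structure IsBernsteinRule {m : ℕ} (p : Fin (m + 2) → smoothFun ℂ) (l₀ l₁ : ℝ)
    (t α : Fin (m + 2) → ℝ) : Prop where
  left : IsExpCoeff p l₀ fun k ↦ α k * Real.exp (l₀ * t k)
  right : IsExpCoeff p l₁ fun k ↦ α k * Real.exp (l₁ * t k)

section rule

variable {m : ℕ} {Λ : Fin (m + 2) → ℂ} {a b l₀ l₁ : ℝ} {p : Fin (m + 2) → smoothFun ℂ}
  {q r : Fin (m + 1) → smoothFun ℂ} {t α : Fin (m + 2) → ℝ}

theorem IsExpCoeff.exists_isBernsteinRule {x y : Fin (m + 2) → ℝ} (hx : IsExpCoeff p l₀ x)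
    (hy : IsExpCoeff p l₁ y) (hl : l₀ < l₁) : ∃ t α, IsBernsteinRule p l₀ l₁ t α := by
  choose t α hα₀ hα₁ using fun k ↦ exists_mul_exp_eq hl (hx.pos k) (hy.pos k)
  exact ⟨t, α, by simpa only [hα₀] using hx, by simpa only [hα₁] using hy⟩

namespace IsBernsteinRule

variable (hα : IsBernsteinRule p l₀ l₁ t α) (hp : IsSmoothBernstein Λ a b p)

include hα

theorem weight_pos (k : Fin (m + 2)) : 0 < α k :=
  pos_of_mul_pos_left (hα.left.pos k) (Real.exp_pos _).le

include hp

theorem apply_zero (hl : l₀ < l₁) : t 0 = a ∧ α 0 = 1 :=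
  eq_and_eq_of_mul_exp_eq hl one_ne_zero
    ((hα.left.apply_zero hp).trans (one_mul _).symm)
    ((hα.right.apply_zero hp).trans (one_mul _).symm)

theorem unique (hl : l₀ < l₁) (hab : a < b) (hB : bernsteinBasis Λ a b = fun k ↦ ⇑(p k))
    {t' α' : Fin (m + 2) → ℝ}
    (h₀ : ∀ x ∈ Icc a b, bernsteinOp Λ a b t' α' (expFun l₀) x = expFun l₀ x)
    (h₁ : ∀ x ∈ Icc a b, bernsteinOp Λ a b t' α' (expFun l₁) x = expFun l₁ x) :
    t' = t ∧ α' = α := by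
  have heq k := eq_and_eq_of_mul_exp_eq hl (hα.weight_pos k).ne'
    (hα.left.eq_of_bernsteinOp_expFun hB hp hab h₀ k)
    (hα.right.eq_of_bernsteinOp_expFun hB hp hab h₁ k)
  exact ⟨funext fun k ↦ (heq k).1, funext fun k ↦ (heq k).2⟩

variable (h : DisconjugacyCriterion Λ a b)

include h

theorem node_last (hl : l₀ < l₁) : t (Fin.last (m + 1)) = b := by
  have hlast₀ := hα.left.apply_last_mul_endDeriv hp h
  have hlast₁ := hα.right.apply_last_mul_endDeriv hp h
  rw [mul_right_comm, ← one_mul (Real.exp (_ * b))] at hlast₀ hlast₁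
  exact (eq_and_eq_of_mul_exp_eq hl one_ne_zero hlast₀ hlast₁).1

variable (h₀ : Λ 0 = l₀) (hd₀ : DisconjugacyCriterion (Fin.removeNth 0 Λ) a b)
  (hq : IsSmoothBernstein (Fin.removeNth 0 Λ) a b q)

include h₀ hd₀ hq

theorem weight_eq (k : Fin (m + 2)) :
    α k = Real.exp (-l₀ * (t k - a)) * (-1) ^ (k : ℕ) *
      ∏ l : Fin (m + 1) with l.castSucc < k, -(endDeriv b p l.castSucc / endDeriv b q l) := by
  have hprod := eq_neg_one_pow_mul_prod (f := fun k ↦ α k * Real.exp (l₀ * t k))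
    (d := fun l ↦ -(endDeriv b p l.castSucc / endDeriv b q l)) (fun l ↦ by
      have hsucc := hα.left.apply_succ_mul_endDeriv hp h hd₀ h₀ hq l
      rw [neg_mul, neg_neg, div_mul_eq_mul_div, eq_div_iff (hq.endDeriv_pos hd₀ l).ne', hsucc,
        mul_comm]) k
  have hexp : Real.exp (-l₀ * (t k - a)) * Real.exp (l₀ * t k) = Real.exp (l₀ * a) := by
    rw [← Real.exp_add]
    congr 1
    ring
  simp only [hα.left.apply_zero hp] at hprod
  refine mul_right_cancel₀ (Real.exp_ne_zero (l₀ * t k)) ?_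
  rw [hprod, ← hexp]
  ring

variable (h₁ : Λ 1 = l₁) (hd₁ : DisconjugacyCriterion (Fin.removeNth 1 Λ) a b)
  (hr : IsSmoothBernstein (Fin.removeNth 1 Λ) a b r)

include h₁ hd₁ hr

theorem exp_node_sub (k : Fin (m + 1)) :
    Real.exp ((l₀ - l₁) * (t k.succ - t k.castSucc)) = endDeriv b r k / endDeriv b q k := by
  have hsucc₀ := hα.left.apply_succ_mul_endDeriv hp h hd₀ h₀ hq k
  have hsucc₁ := hα.right.apply_succ_mul_endDeriv hp h hd₁ h₁ hr k
  have hexp : Real.exp ((l₀ - l₁) * (t k.succ - t k.castSucc)) *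
      (Real.exp (l₁ * t k.succ) * Real.exp (l₀ * t k.castSucc)) =
        Real.exp (l₀ * t k.succ) * Real.exp (l₁ * t k.castSucc) := by
    simp only [← Real.exp_add]
    congr 1
    ring
  have hne : α k.succ * (Real.exp (l₁ * t k.succ) * Real.exp (l₀ * t k.castSucc)) ≠ 0 :=
    mul_ne_zero (hα.weight_pos _).ne' (by positivity)
  rw [eq_div_iff (hq.endDeriv_pos hd₀ k).ne']
  refine mul_left_cancel₀ hne ?_
  linear_combination α k.succ * endDeriv b q k * hexp + Real.exp (l₁ * t k.castSucc) * hsucc₀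
    - Real.exp (l₀ * t k.castSucc) * hsucc₁

theorem strictMono (hl : l₀ < l₁) : StrictMono t := by
  refine Fin.strictMono_iff_lt_succ.2 fun k ↦ ?_
  have hratio : endDeriv b r k / endDeriv b q k < 1 :=
    (div_lt_one (hq.endDeriv_pos hd₀ k)).2 (hq.endDeriv_lt hr hp h h₀ h₁ hl)
  rw [← hα.exp_node_sub hp h h₀ hd₀ hq h₁ hd₁ hr, Real.exp_lt_one_iff] at hratio
  exact sub_pos.1 (pos_of_mul_neg_right hratio (sub_neg.2 hl).le)

end IsBernsteinRule

end rule

theorem DisconjugacyCriterion.of_maxAbsIm {n : ℕ} {Λ : Fin (n + 1) → ℂ} {a b : ℝ}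
    (hΛ : ClosedUnderConj (expPoly Λ)) (hab : a < b) (h : (b - a) * maxAbsIm Λ < Real.pi) :
    DisconjugacyCriterion Λ a b where
  lt := hab
  map_conj := map_conj_charPoly hΛ
  width i := (mul_le_mul_of_nonneg_left
    (Finset.le_sup' (fun j ↦ |(Λ j).im|) (Finset.mem_univ i)) (sub_nonneg.2 hab.le)).trans_lt h

/-- The eigenvalues are `lam 0, …, lam n` with `n = m + 1 ≥ 1`; `Fin.removeNth 0 lam` is
`(lam 1, …, lam n)` and `Fin.removeNth 1 lam` is `(lam 0, lam 2, …, lam n)`. The condition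
`(b - a) * M < π` is `b - a < π / M`, with `π / 0 = ∞`. -/
theorem theorem3p1 (m : ℕ) (lam : Fin (m + 2) → ℂ) (l₀ l₁ a b : ℝ)
    (h₀ : lam 0 = (l₀ : ℂ)) (h₁ : lam 1 = (l₁ : ℂ)) (hlt : l₀ < l₁)
    (hconj : ClosedUnderConj (expPoly lam))
    (hab : 0 < b - a) (hM : (b - a) * maxAbsIm lam < Real.pi) :
    -- the three Bernstein bases exist and are unique
    (∃! p, IsBernsteinBasis lam a b p) ∧
    (∃! p, IsBernsteinBasis (n := m) (Fin.removeNth 0 lam) a b p) ∧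
    (∃! p, IsBernsteinBasis (n := m) (Fin.removeNth 1 lam) a b p) ∧
    ∃ t α : Fin (m + 2) → ℝ,
      -- the inductive definition of the nodes
      (t 0 = a ∧ ∀ k : Fin (m + 1),
        Filter.Tendsto
          (fun x => bernsteinBasis (n := m) (Fin.removeNth 1 lam) a b k x /
            bernsteinBasis (n := m) (Fin.removeNth 0 lam) a b k x)
          (nhdsWithin b {b}ᶜ)
          (nhds ((Real.exp ((l₀ - l₁) * (t k.succ - t k.castSucc)) : ℝ) : ℂ))) ∧
      StrictMono t ∧ t (Fin.last (m + 1)) = b ∧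
      -- the definition of the weights
      α 0 = 1 ∧
      (∃ d : Fin (m + 1) → ℝ,
        (∀ l : Fin (m + 1),
          Filter.Tendsto
            (fun x => deriv (bernsteinBasis lam a b l.castSucc) x /
              bernsteinBasis (n := m) (Fin.removeNth 0 lam) a b l x)
            (nhdsWithin b {b}ᶜ) (nhds (d l : ℂ))) ∧
        ∀ k : Fin (m + 2), k ≠ 0 →
          α k = Real.exp (-l₀ * (t k - a)) * (-1) ^ (k : ℕ) *
            ∏ l : Fin (m + 1) with l.castSucc < k, d l) ∧
      (∀ k, 0 < α k) ∧
      -- the operator fixes the two exponentials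
      bernsteinOp lam a b t α (expFun l₀) = expFun l₀ ∧
      bernsteinOp lam a b t α (expFun l₁) = expFun l₁ ∧
      -- uniqueness among all real nodes and weights
      ∀ t' α' : Fin (m + 2) → ℝ,
        (∀ x ∈ Set.Icc a b, bernsteinOp lam a b t' α' (expFun l₀) x = expFun l₀ x) →
        (∀ x ∈ Set.Icc a b, bernsteinOp lam a b t' α' (expFun l₁) x = expFun l₁ x) →
        t' = t ∧ α' = α := by
  have h : DisconjugacyCriterion lam a b := .of_maxAbsIm hconj (sub_pos.1 hab) hM
  have hd₀ := h.removeNth 0 (by rw [h₀, Complex.conj_ofReal])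
  have hd₁ := h.removeNth 1 (by rw [h₁, Complex.conj_ofReal])
  obtain ⟨p, hp, hpB⟩ := h.exists_bernsteinBasis_eq
  obtain ⟨q, hq, hqB⟩ := DisconjugacyCriterion.exists_bernsteinBasis_eq (n := m) hd₀
  obtain ⟨r, hr, hrB⟩ := DisconjugacyCriterion.exists_bernsteinBasis_eq (n := m) hd₁
  obtain ⟨x, hx⟩ := hp.exists_isExpCoeff h hd₀ hq h₀
  obtain ⟨y, hy⟩ := hp.exists_isExpCoeff h hd₁ hr h₁
  obtain ⟨t, α, hα⟩ := hx.exists_isBernsteinRule hy hlt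
  have ⟨ht, hα₀⟩ := hα.apply_zero hp hlt
  refine ⟨h.existsUnique_isBernsteinBasis, hd₀.existsUnique_isBernsteinBasis,
    hd₁.existsUnique_isBernsteinBasis, t, α, ⟨ht, fun k ↦ ?_⟩,
    hα.strictMono hp h h₀ hd₀ hq h₁ hd₁ hr hlt, hα.node_last hp h hlt, hα₀,
    ⟨_, fun l ↦ ?_, fun k _ ↦ hα.weight_eq hp h h₀ hd₀ hq k⟩, hα.weight_pos,
    bernsteinOp_expFun_eq hpB hα.left, bernsteinOp_expFun_eq hpB hα.right,
    fun _ _ ↦ hα.unique hp hlt h.lt hpB⟩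
  · rw [hqB, hrB, hα.exp_node_sub hp h h₀ hd₀ hq h₁ hd₁ hr]
    exact hq.tendsto_div hr hd₀ hd₁ k
  · rw [hpB, hqB]
    exact hp.tendsto_deriv_div hq h hd₀ l
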